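/- A finite hypergraph $H=(V,\mathcal E)$ has nonempty hyperedges (distinct hyperedges may contain the same vertices); write $m=|\mathcal E|$ and $N=\sum_{E\in\mathcal E}|E|$. It is given by (the adjacency lists of) its incidence graph, which is assumed to be connected. $H$ is ($\alpha$-)acyclic if it has a join tree, i.e. a tree whose nodes are the hyperedges of $H$ such that for every $v\in V$ the hyperedges containing $v$ induce a subtree. The subset graph of $H$ is the directed graph whose vertices are the hyperedges of $H$, with an edge from $E$ to $E'\neq E$ if and only if $E\subseteq E'$; constructing it means producing the list of its edges. Algorithms are programs of a word RAM (unit cost per operation) whose words have at least $c\log N$ bits for a constant $c$ depending on the program; for satisfiability, at least $c\,(n+\log L)$ bits. A function $T(N)$ is truly subquadratic if $T(N)\in\mathcal O(N^{2-\varepsilon})$ for some constant $\varepsilon>0$. The Strong Exponential Time Hypothesis (SETH) states that for no constant $\varepsilon>0$ there is an algorithm deciding the satisfiability of CNF formulas (without limitation on the clause size) with $n$ variables and length $L$ in time $\mathcal O\bigl((2-\varepsilon)^n\cdot L^{k}\bigr)$ for some constant $k$. **Theorem.** If the SETH is true, then there is no algorithm which constructs the subset graph of a given acyclic hypergraph in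 truly subquadratic time $T(N)$. This holds even if the subset graph is sparse: there is no algorithm which constructs the subset graph of every acyclic hypergraph and whose running time is bounded by a truly subquadratic function of $N$ on all acyclic hypergraphs whose subset graph has at most $m$ edges. -/

import Mathlib

/-! ## A word RAM with a step count

A program uses finitely many registers and finitely many random access arrays. Registers and array
cells hold `w`-bit words, and arrays are addressed by words. A program is written without reference
to the word length `w`. -/

namespace WordRAM

/-- The binary operations on words that the machine performs in one step. -/
inductive BinOp where
  | add | sub | mul | div | mod | and | or | xor | shl | shr | lt | eq

/-- Arithmetic is modulo `2 ^ w`; words are unsigned; comparisons return `1` or `0`. -/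
def BinOp.eval {w : ℕ} : BinOp → BitVec w → BitVec w → BitVec w
  | .add, a, b => a + b
  | .sub, a, b => a - b
  | .mul, a, b => a * b
  | .div, a, b => a / b
  | .mod, a, b => a % b
  | .and, a, b => a &&& b
  | .or, a, b => a ||| b
  | .xor, a, b => a ^^^ b
  | .shl, a, b => a <<< b
  | .shr, a, b => a >>> b
  | .lt, a, b => if a.toNat < b.toNat then 1#w else 0#w
  | .eq, a, b => if a = b then 1#w else 0#w

/-- Programs. Registers and arrays are named by natural numbers. -/
inductive Prog where
  /-- do nothing -/
  | skip
  /-- `reg r := k` -/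
  | const (r k : ℕ)
  /-- `reg r := reg a ∘ reg b` -/
  | op (o : BinOp) (r a b : ℕ)
  /-- `reg r := arr[reg i]` -/
  | load (r arr i : ℕ)
  /-- `arr[reg i] := reg r` -/
  | store (arr i r : ℕ)
  /-- `p; q` -/
  | seq (p q : Prog)
  /-- `if reg r ≠ 0 then p else q` -/
  | ite (r : ℕ) (p q : Prog)
  /-- `while reg r ≠ 0 do p` -/
  | loop (r : ℕ) (p : Prog)

/-- The contents of the registers and of the arrays. -/
structure State (w : ℕ) where
  reg : ℕ → BitVec w
  arr : ℕ → BitVec w → BitVec w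

/-- `reg r := x`. -/
def State.setReg {w : ℕ} (s : State w) (r : ℕ) (x : BitVec w) : State w :=
  { s with reg := Function.update s.reg r x }

/-- `arr A [i] := x`. -/
def State.setArr {w : ℕ} (s : State w) (A : ℕ) (i x : BitVec w) : State w :=
  { s with arr := Function.update s.arr A (Function.update (s.arr A) i x) }

/-- `Exec p s t s'`: started in `s`, the program `p` halts after exactly `t` steps in `s'`.
Every elementary instruction and every test costs one step. -/
inductive Exec {w : ℕ} : Prog → State w → ℕ → State w → Prop where
  | skip (s : State w) : Exec .skip s 1 s
  | const (s : State w) (r k : ℕ) : Exec (.const r k) s 1 (s.setReg r (BitVec.ofNat w k))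
  | op (s : State w) (o : BinOp) (r a b : ℕ) :
      Exec (.op o r a b) s 1 (s.setReg r (o.eval (s.reg a) (s.reg b)))
  | load (s : State w) (r A i : ℕ) : Exec (.load r A i) s 1 (s.setReg r (s.arr A (s.reg i)))
  | store (s : State w) (A i r : ℕ) : Exec (.store A i r) s 1 (s.setArr A (s.reg i) (s.reg r))
  | seq {p q : Prog} {s₁ s₂ s₃ : State w} {t₁ t₂ : ℕ} :
      Exec p s₁ t₁ s₂ → Exec q s₂ t₂ s₃ → Exec (.seq p q) s₁ (t₁ + t₂) s₃
  | iteTrue {r : ℕ} {p q : Prog} {s s' : State w} {t : ℕ} :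
      s.reg r ≠ 0#w → Exec p s t s' → Exec (.ite r p q) s (t + 1) s'
  | iteFalse {r : ℕ} {p q : Prog} {s s' : State w} {t : ℕ} :
      s.reg r = 0#w → Exec q s t s' → Exec (.ite r p q) s (t + 1) s'
  | loopDone {r : ℕ} {p : Prog} {s : State w} :
      s.reg r = 0#w → Exec (.loop r p) s 1 s
  | loopStep {r : ℕ} {p : Prog} {s₁ s₂ s₃ : State w} {t₁ t₂ : ℕ} :
      s₁.reg r ≠ 0#w → Exec p s₁ t₁ s₂ → Exec (.loop r p) s₂ t₂ s₃ →
      Exec (.loop r p) s₁ (t₁ + t₂ + 1) s₃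

/-- The input is in array `0`; everything else is `0`. -/
def init (w : ℕ) (input : List ℕ) : State w where
  reg _ := 0#w
  arr A i := if A = 0 then BitVec.ofNat w (input.getD i.toNat 0) else 0#w

/-- The output is read from the beginning of array `1`. In particular all entries of `out` fit
into words and all their positions are addressable. -/
def State.HasOutput {w : ℕ} (s : State w) (out : List ℕ) : Prop :=
  out.length ≤ 2 ^ w ∧
    ∀ (i : ℕ) (hi : i < out.length), (s.arr 1 (BitVec.ofNat w i)).toNat = out[i]

end WordRAM

/-! ## Satisfiability and the Strong Exponential Time Hypothesis -/

/-- A formula in conjunctive normal form over the variables `0, …, numVars - 1`, with no limit on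
the clause size. The literal `(x, true)` is `x`, the literal `(x, false)` is its negation. -/
structure CNFFormula where
  numVars : ℕ
  clauses : List (List (Fin numVars × Bool))

namespace CNFFormula

def Satisfiable (φ : CNFFormula) : Prop :=
  ∃ a : Fin φ.numVars → Bool, ∀ c ∈ φ.clauses, ∃ l ∈ c, a l.1 = l.2

/-- Number of variables, number of clauses, then every clause as its length followed by its
literals, where the literals of variable `x` are `2 x` (negative) and `2 x + 1` (positive). -/
def encode (φ : CNFFormula) : List ℕ :=
  φ.numVars :: φ.clauses.length ::
    φ.clauses.flatMap fun c => c.length :: c.map fun l => 2 * (l.1 : ℕ) + l.2.toNat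

/-- The length of the formula (in words). -/
def length (φ : CNFFormula) : ℕ := φ.encode.length

end CNFFormula

open Classical in
/-- The program `P` decides satisfiability of every formula `φ` within `T φ` steps, on every word
RAM whose word length is at least a constant times `numVars + log length`
(so that exponentially large memories are addressable). -/
def DecidesSAT (P : WordRAM.Prog) (T : CNFFormula → ℝ) : Prop :=
  ∃ c : ℕ, ∀ (φ : CNFFormula) (w : ℕ), c * (φ.numVars + Nat.log 2 φ.length + 1) ≤ w →
    ∃ (t : ℕ) (s : WordRAM.State w), WordRAM.Exec P (WordRAM.init w φ.encode) t s ∧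
      s.HasOutput [if φ.Satisfiable then 1 else 0] ∧ (t : ℝ) ≤ T φ

/-- The Strong Exponential Time Hypothesis: for no `ε > 0` can satisfiability (without limitation
on the clause size) be decided in time `O((2 - ε) ^ n)`, up to factors polynomial in the length
of the formula, where `n` is the number of variables. -/
def SETH : Prop :=
  ∀ ε : ℝ, 0 < ε → ε < 1 → ¬ ∃ (P : WordRAM.Prog) (C : ℝ) (k : ℕ),
    DecidesSAT P fun φ => C * (2 - ε) ^ φ.numVars * (φ.length : ℝ) ^ k

/-! ## Hypergraphs -/

/-- A finite hypergraph with vertices `0, …, n - 1` and nonempty hyperedges indexed by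
`0, …, m - 1`. Different hyperedges may contain the same vertices. -/
structure FinHypergraph where
  n : ℕ
  m : ℕ
  edge : Fin m → Finset (Fin n)
  edge_nonempty : ∀ e, (edge e).Nonempty

namespace FinHypergraph

/-- The total size `N` of all hyperedges. -/
def size (H : FinHypergraph) : ℕ := ∑ e, (H.edge e).card

/-- The bipartite incidence graph of vertices and hyperedges. -/
def incidenceGraph (H : FinHypergraph) : SimpleGraph (Fin H.n ⊕ Fin H.m) :=
  SimpleGraph.fromRel fun x y => ∃ v e, x = Sum.inl v ∧ y = Sum.inr e ∧ v ∈ H.edge e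

/-- A join tree: a tree on the hyperedges in which, for every vertex, the hyperedges containing
that vertex induce a subtree. -/
def IsJoinTree (H : FinHypergraph) (T : SimpleGraph (Fin H.m)) : Prop :=
  T.IsTree ∧ ∀ v : Fin H.n, (T.induce {e | v ∈ H.edge e}).Preconnected

/-- (`α`-)acyclic hypergraphs are those that have a join tree. -/
def IsAcyclic (H : FinHypergraph) : Prop := ∃ T, H.IsJoinTree T

/-- The subset graph: an edge from `e` to a different `f` if `e` is a subset of `f`. -/
def subsetGraph (H : FinHypergraph) : Digraph (Fin H.m) where
  Adj e f := e ≠ f ∧ H.edge e ⊆ H.edge f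

/-- The subset graph has at most as many edges as vertices. -/
def HasSparseSubsetGraph (H : FinHypergraph) : Prop :=
  {p : Fin H.m × Fin H.m | H.subsetGraph.Adj p.1 p.2}.ncard ≤ H.m

/-- The incidence graph by adjacency lists: number of vertices, number of hyperedges, then every
hyperedge as its cardinality followed by its vertices in increasing order. -/
def encode (H : FinHypergraph) : List ℕ :=
  H.n :: H.m :: (List.finRange H.m).flatMap fun e =>
    (H.edge e).card :: ((List.finRange H.n).filter (· ∈ H.edge e)).map Fin.val

end FinHypergraph

/-- `out` describes the directed graph `G`: the number of edges, followed by the edges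
(as pairs of vertices), each listed once, in some order. -/
def IsEdgeList {m : ℕ} (G : Digraph (Fin m)) (out : List ℕ) : Prop :=
  ∃ l : List (Fin m × Fin m), l.Nodup ∧ (∀ u v, (u, v) ∈ l ↔ G.Adj u v) ∧
    out = l.length :: l.flatMap fun p => [(p.1 : ℕ), (p.2 : ℕ)]

/-- The program `P` constructs the subset graph of every acyclic hypergraph (with connected
incidence graph), on every word RAM whose word length is at least a constant times `log N`, and on
those hypergraphs that belong to `𝒞` it needs at most `T N` steps. -/
def ConstructsSubsetGraphs (P : WordRAM.Prog) (𝒞 : FinHypergraph → Prop) (T : ℕ → ℝ) : Prop :=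
  ∃ c : ℕ, ∀ H : FinHypergraph, H.IsAcyclic → H.incidenceGraph.Connected →
    ∀ w : ℕ, c * (Nat.log 2 H.size + 1) ≤ w →
      ∃ (t : ℕ) (s : WordRAM.State w), WordRAM.Exec P (WordRAM.init w H.encode) t s ∧
        (∃ out, IsEdgeList H.subsetGraph out ∧ s.HasOutput out) ∧
        (𝒞 H → (t : ℝ) ≤ T H.size)

/-- `T(N) ∈ O(N ^ (2 - ε))` for some constant `ε > 0`. -/
def TrulySubquadratic (T : ℕ → ℝ) : Prop :=
  ∃ ε : ℝ, 0 < ε ∧ T =O[Filter.atTop] fun N : ℕ => (N : ℝ) ^ (2 - ε)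

/-! The proof is a split-and-list reduction. Let φ be a formula with n variables and let h = `half`,
about n/2. The variables, padded to 2h, are distributed over two sides of size h. The hypergraph
`subsetHypergraph` has 2^h hyperedges for the partial assignments of side 0, 2^h for those of side
1, and one hyperedge containing every vertex. A hyperedge e of side 0 contains the clauses that it
does not satisfy, a hyperedge f of side 1 those that it satisfies; so, on the clauses, e ⊆ f says
that e and f together satisfy φ. The literal vertices exclude unwanted inclusions: a hyperedge
contains the true literals of its own side, which makes each side an antichain, and all literals of
lower sides, which permits inclusions only upwards. The full hyperedge is the centre of a star that
serves as join tree.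

Hence the subset graph consists of 2 * 2^h edges into the full hyperedge and one edge for each pair
that forms a satisfying assignment (`adj_iff`). So φ is unsatisfiable iff there are exactly 2 * 2^h
= m - 1 edges (`length_eq_iff`), and in that case the subset graph is sparse.

With b vertices, N ≤ 3 * 2^h * b, so a truly subquadratic bound is below D * b^2 * 2^(2h - h/q) for
constants D, q. Up to polynomial factors this is 2^(n - n/(2q)), which contradicts SETH. The bound
is only available for sparse subset graphs, while a satisfiable formula may produce a dense one.
Therefore the construction runs under a clock (`Exec.clocked`): exceeding a budget that suffices for
every unsatisfiable formula proves satisfiability, and otherwise the edge count decides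
(`runs_satProg`). What remains is a word RAM program that writes the hypergraph (`runs_buildProg`),
and bounds on word length (`exists_word_length`) and time (`total_time_le`). -/

namespace WordRAM

variable {w : ℕ}

/-! ### Bounded runs -/

@[simp] theorem State.reg_setReg (s : State w) (r r' : ℕ) (x : BitVec w) :
    (s.setReg r x).reg r' = if r' = r then x else s.reg r' := by
  simp [State.setReg, Function.update_apply]

@[simp] theorem State.arr_setReg (s : State w) (r : ℕ) (x : BitVec w) :
    (s.setReg r x).arr = s.arr := rfl

@[simp] theorem State.reg_setArr (s : State w) (A : ℕ) (i x : BitVec w) :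
    (s.setArr A i x).reg = s.reg := rfl

@[simp] theorem State.arr_setArr (s : State w) (A A' : ℕ) (i x : BitVec w) :
    (s.setArr A i x).arr A' = if A' = A then Function.update (s.arr A) i x else s.arr A' := by
  simp [State.setArr, Function.update_apply]

/-- Started in `s`, the program `p` halts within `T` steps in a state satisfying `Q`. -/
def Runs (p : Prog) (s : State w) (T : ℕ) (Q : State w → Prop) : Prop :=
  ∃ t s', Exec p s t s' ∧ t ≤ T ∧ Q s'

theorem Runs.mono {p : Prog} {s : State w} {T T' : ℕ} {Q Q' : State w → Prop}
    (h : Runs p s T Q) (hT : T ≤ T') (hQ : ∀ s', Q s' → Q' s') : Runs p s T' Q' := by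
  obtain ⟨t, s', h₁, h₂, h₃⟩ := h
  exact ⟨t, s', h₁, h₂.trans hT, hQ _ h₃⟩

theorem Runs.seq {p q : Prog} {s : State w} {T₁ T₂ : ℕ} {R Q : State w → Prop}
    (hp : Runs p s T₁ R) (hq : ∀ s', R s' → Runs q s' T₂ Q) :
    Runs (.seq p q) s (T₁ + T₂) Q := by
  obtain ⟨t₁, s₁, h₁, ht₁, hR⟩ := hp
  obtain ⟨t₂, s₂, h₂, ht₂, hQ⟩ := hq s₁ hR
  exact ⟨_, _, .seq h₁ h₂, Nat.add_le_add ht₁ ht₂, hQ⟩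

theorem Runs.ite {r : ℕ} {p q : Prog} {s : State w} {T : ℕ} {Q : State w → Prop}
    (hp : s.reg r ≠ 0#w → Runs p s T Q) (hq : s.reg r = 0#w → Runs q s T Q) :
    Runs (.ite r p q) s (T + 1) Q := by
  by_cases h : s.reg r = 0#w
  · obtain ⟨t, s', h₁, ht, hQ⟩ := hq h
    exact ⟨_, _, .iteFalse h h₁, Nat.add_le_add_right ht 1, hQ⟩
  · obtain ⟨t, s', h₁, ht, hQ⟩ := hp h
    exact ⟨_, _, .iteTrue h h₁, Nat.add_le_add_right ht 1, hQ⟩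

/-- A loop whose invariant `I` carries the number of remaining iterations. -/
theorem Runs.loop {r : ℕ} {p : Prog} {T : ℕ} (I : ℕ → State w → Prop)
    (hstep : ∀ k s, I (k + 1) s → s.reg r ≠ 0#w ∧ Runs p s T (I k))
    (hdone : ∀ s, I 0 s → s.reg r = 0#w) (n : ℕ) {s : State w} (h : I n s) :
    Runs (.loop r p) s (n * (T + 1) + 1) (I 0) := by
  induction n generalizing s with
  | zero => exact ⟨1, s, .loopDone (hdone s h), by simp, h⟩
  | succ k ih =>
    obtain ⟨hr, t₁, s₁, h₁, ht₁, hI⟩ := hstep k s h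
    obtain ⟨t₂, s₂, h₂, ht₂, hQ⟩ := ih hI
    exact ⟨_, _, .loopStep hr h₁ h₂, by rw [Nat.succ_mul]; omega, hQ⟩

/-! ### Loop-free programs: symbolic execution. -/

/-- The final state of a program without loops. -/
def Prog.run : Prog → State w → State w
  | .skip, s => s
  | .const r k, s => s.setReg r (BitVec.ofNat w k)
  | .op o r a b, s => s.setReg r (o.eval (s.reg a) (s.reg b))
  | .load r A i, s => s.setReg r (s.arr A (s.reg i))
  | .store A i r, s => s.setArr A (s.reg i) (s.reg r)
  | .seq p q, s => q.run (p.run s)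
  | .ite r p q, s => if s.reg r = 0#w then q.run s else p.run s
  | .loop _ _, s => s

/-- An upper bound for the number of steps of a program without loops. -/
def Prog.cost : Prog → ℕ
  | .seq p q => p.cost + q.cost
  | .ite _ p q => p.cost + q.cost + 1
  | _ => 1

def Prog.LoopFree : Prog → Prop
  | .seq p q => p.LoopFree ∧ q.LoopFree
  | .ite _ p q => p.LoopFree ∧ q.LoopFree
  | .loop _ _ => False
  | _ => True

/-- Straight-line code becomes a computation of `Prog.run` by `simp`; only loops need invariants. -/
theorem Runs.of_loopFree {p : Prog} (hp : p.LoopFree) (s : State w) :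
    Runs p s p.cost (fun s' => s' = p.run s) := by
  induction p generalizing s with
  | skip => exact ⟨_, _, .skip s, le_rfl, rfl⟩
  | const r k => exact ⟨_, _, .const s r k, le_rfl, rfl⟩
  | op o r a b => exact ⟨_, _, .op s o r a b, le_rfl, rfl⟩
  | load r A i => exact ⟨_, _, .load s r A i, le_rfl, rfl⟩
  | store A i r => exact ⟨_, _, .store s A i r, le_rfl, rfl⟩
  | seq p q ihp ihq =>
    exact (ihp hp.1 s).seq fun s' hs' => by subst hs'; exact ihq hp.2 _
  | ite r p q ihp ihq =>
    refine Runs.ite (fun h => ?_) (fun h => ?_)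
    · exact (ihp hp.1 s).mono (Nat.le_add_right _ _) fun s' hs' => by simp [Prog.run, h, hs']
    · exact (ihq hp.2 s).mono (Nat.le_add_left _ _) fun s' hs' => by simp [Prog.run, h, hs']
  | loop r p => exact hp.elim

/-! ### Frame properties: memory that a program never writes. -/

/-- The register `r` occurs as the target of an instruction. -/
def Prog.WritesReg (r : ℕ) : Prog → Prop
  | .const r' _ | .op _ r' _ _ | .load r' _ _ => r = r'
  | .seq p q | .ite _ p q => p.WritesReg r ∨ q.WritesReg r
  | .loop _ p => p.WritesReg r
  | _ => False

/-- The array `A` occurs as the target of an instruction. -/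
def Prog.WritesArr (A : ℕ) : Prog → Prop
  | .store A' _ _ => A = A'
  | .seq p q | .ite _ p q => p.WritesArr A ∨ q.WritesArr A
  | .loop _ p => p.WritesArr A
  | _ => False

theorem Exec.reg_eq {p : Prog} {s s' : State w} {t r : ℕ} (h : Exec p s t s')
    (hr : ¬ p.WritesReg r) : s'.reg r = s.reg r := by
  induction h <;> simp_all [Prog.WritesReg]

theorem Exec.arr_eq {p : Prog} {s s' : State w} {t A : ℕ} (h : Exec p s t s')
    (hA : ¬ p.WritesArr A) : s'.arr A = s.arr A := by
  induction h <;> simp_all [Prog.WritesArr]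

theorem Runs.frame {p : Prog} {s : State w} {T : ℕ} {Q : State w → Prop} (h : Runs p s T Q) :
    Runs p s T (fun s' => Q s' ∧ (∀ r, ¬ p.WritesReg r → s'.reg r = s.reg r) ∧
      ∀ A, ¬ p.WritesArr A → s'.arr A = s.arr A) := by
  obtain ⟨t, s', h₁, h₂, h₃⟩ := h
  exact ⟨t, s', h₁, h₂, h₃, fun _ => h₁.reg_eq, fun _ => h₁.arr_eq⟩

/-! ### Words as numbers -/

theorem ofNat_eq_zero_iff {a : ℕ} (ha : a < 2 ^ w) : BitVec.ofNat w a = 0#w ↔ a = 0 := by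
  rw [← BitVec.toNat_inj]; simp [Nat.mod_eq_of_lt ha]

theorem ofNat_inj_iff {a b : ℕ} (ha : a < 2 ^ w) (hb : b < 2 ^ w) :
    BitVec.ofNat w a = BitVec.ofNat w b ↔ a = b := by
  rw [← BitVec.toNat_inj]; simp [Nat.mod_eq_of_lt ha, Nat.mod_eq_of_lt hb]

theorem eval_add (a b : ℕ) :
    BinOp.add.eval (BitVec.ofNat w a) (BitVec.ofNat w b) = BitVec.ofNat w (a + b) := by
  simp [BinOp.eval, BitVec.ofNat_add]

theorem eval_mul (a b : ℕ) :
    BinOp.mul.eval (BitVec.ofNat w a) (BitVec.ofNat w b) = BitVec.ofNat w (a * b) := by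
  simp [BinOp.eval, BitVec.ofNat_mul]

theorem eval_sub {a b : ℕ} (h : b ≤ a) :
    BinOp.sub.eval (BitVec.ofNat w a) (BitVec.ofNat w b) = BitVec.ofNat w (a - b) := by
  obtain ⟨c, rfl⟩ := Nat.exists_eq_add_of_le h
  rw [Nat.add_comm b c, Nat.add_sub_cancel]
  simp only [BinOp.eval, BitVec.ofNat_add]
  exact BitVec.add_sub_cancel _ _

theorem eval_div {a b : ℕ} (ha : a < 2 ^ w) (hb : b < 2 ^ w) :
    BinOp.div.eval (BitVec.ofNat w a) (BitVec.ofNat w b) = BitVec.ofNat w (a / b) := by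
  rw [← BitVec.toNat_inj]
  simp [BinOp.eval, Nat.mod_eq_of_lt ha, Nat.mod_eq_of_lt hb,
    Nat.mod_eq_of_lt ((Nat.div_le_self a b).trans_lt ha)]

theorem eval_mod {a b : ℕ} (ha : a < 2 ^ w) (hb : b < 2 ^ w) :
    BinOp.mod.eval (BitVec.ofNat w a) (BitVec.ofNat w b) = BitVec.ofNat w (a % b) := by
  rw [← BitVec.toNat_inj]
  simp [BinOp.eval, Nat.mod_eq_of_lt ha, Nat.mod_eq_of_lt hb,
    Nat.mod_eq_of_lt ((Nat.mod_le a b).trans_lt ha)]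

theorem eval_shr {a b : ℕ} (ha : a < 2 ^ w) (hb : b < 2 ^ w) :
    BinOp.shr.eval (BitVec.ofNat w a) (BitVec.ofNat w b) = BitVec.ofNat w (a / 2 ^ b) := by
  rw [← BitVec.toNat_inj]
  simp [BinOp.eval, Nat.mod_eq_of_lt ha, Nat.mod_eq_of_lt hb, Nat.shiftRight_eq_div_pow,
    Nat.mod_eq_of_lt ((Nat.div_le_self a (2 ^ b)).trans_lt ha)]

theorem eval_shl {a b : ℕ} (hb : b < 2 ^ w) :
    BinOp.shl.eval (BitVec.ofNat w a) (BitVec.ofNat w b) = BitVec.ofNat w (a * 2 ^ b) := by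
  rw [← BitVec.toNat_inj]
  simp [BinOp.eval, Nat.mod_eq_of_lt hb, Nat.shiftLeft_eq]

theorem eval_lt {a b : ℕ} (ha : a < 2 ^ w) (hb : b < 2 ^ w) :
    BinOp.lt.eval (BitVec.ofNat w a) (BitVec.ofNat w b) =
      BitVec.ofNat w (decide (a < b)).toNat := by
  simp only [BinOp.eval, BitVec.toNat_ofNat, Nat.mod_eq_of_lt ha, Nat.mod_eq_of_lt hb]
  split_ifs with h <;> simp [h]

theorem eval_eq {a b : ℕ} (ha : a < 2 ^ w) (hb : b < 2 ^ w) :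
    BinOp.eq.eval (BitVec.ofNat w a) (BitVec.ofNat w b) =
      BitVec.ofNat w (decide (a = b)).toNat := by
  simp only [BinOp.eval, ofNat_inj_iff ha hb]
  split_ifs with h <;> simp [h]

theorem eval_eq_word (a b : BitVec w) :
    BinOp.eq.eval a b = if a = b then 1#w else 0#w := rfl

theorem eval_and_bool (a b : Bool) :
    BinOp.and.eval (BitVec.ofNat w a.toNat) (BitVec.ofNat w b.toNat) =
      BitVec.ofNat w (a && b).toNat := by
  cases a <;> cases b <;> simp [BinOp.eval]

theorem eval_or_bool (a b : Bool) :
    BinOp.or.eval (BitVec.ofNat w a.toNat) (BitVec.ofNat w b.toNat) =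
      BitVec.ofNat w (a || b).toNat := by
  cases a <;> cases b <;> simp [BinOp.eval]

/-- The machine has no move instruction; `or` of a register with itself serves as one. -/
theorem eval_or_self (a : BitVec w) : BinOp.or.eval a a = a := by
  simp [BinOp.eval]

theorem toNat_bool_lt (hw : 0 < w) (b : Bool) : b.toNat < 2 ^ w :=
  (Bool.toNat_lt b).trans_le (Nat.pow_le_pow_right (n := 2) (by norm_num) hw)

/-! ### Lists stored in arrays. -/

/-- The contents of an array that holds a list. -/
def arrOf (w : ℕ) (l : List ℕ) : BitVec w → BitVec w :=
  fun i => BitVec.ofNat w (l.getD i.toNat 0)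

theorem arrOf_nil : arrOf w [] = fun _ => 0#w := by
  funext i; simp [arrOf]

theorem arrOf_ofNat {l : List ℕ} {i : ℕ} (hi : i < 2 ^ w) :
    arrOf w l (BitVec.ofNat w i) = BitVec.ofNat w (l.getD i 0) := by
  simp [arrOf, Nat.mod_eq_of_lt hi]

theorem arrOf_of_drop {l l' : List ℕ} {i x : ℕ} (hi : i < 2 ^ w) (h : l.drop i = x :: l') :
    arrOf w l (BitVec.ofNat w i) = BitVec.ofNat w x := by
  have : l[i]? = some x := by
    have := congrArg (fun k => k[0]?) h
    simpa using this
  rw [arrOf_ofNat hi, List.getD_eq_getElem?_getD, this]; rfl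

theorem drop_succ_of_drop {l l' : List ℕ} {i x : ℕ} (h : l.drop i = x :: l') :
    l.drop (i + 1) = l' := by
  rw [← List.drop_drop, h]; rfl

theorem update_arrOf_set {l : List ℕ} {i x : ℕ} (hi : i < 2 ^ w) (hl : i < l.length) :
    Function.update (arrOf w l) (BitVec.ofNat w i) (BitVec.ofNat w x) = arrOf w (l.set i x) := by
  funext j
  have hj : j = BitVec.ofNat w i ↔ i = j.toNat := by
    rw [← BitVec.toNat_inj]; simp [Nat.mod_eq_of_lt hi, eq_comm]
  by_cases h : i = j.toNat
  · rw [hj.2 h]; simp [arrOf, Nat.mod_eq_of_lt hi, List.getD_eq_getElem?_getD, hl]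
  · rw [Function.update_of_ne (fun h' => h (hj.1 h'))]
    simp [arrOf, List.getD_eq_getElem?_getD, List.getElem?_set_ne h]

/-- Cells beyond the list read 0. Thus appending is overwriting a 0, and a cell can be reserved
without writing to it. -/
theorem arrOf_append_zero (l : List ℕ) : arrOf w (l ++ [0]) = arrOf w l := by
  funext j
  simp only [arrOf, List.getD_eq_getElem?_getD, List.getElem?_append]
  split_ifs with h
  · rfl
  · rw [List.getElem?_eq_none (l := l) (by omega)]
    rcases hk : j.toNat - l.length with _ | k <;> simp

theorem update_arrOf_length {l : List ℕ} {x : ℕ} (hl : l.length < 2 ^ w) :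
    Function.update (arrOf w l) (BitVec.ofNat w l.length) (BitVec.ofNat w x) =
      arrOf w (l ++ [x]) := by
  rw [← arrOf_append_zero, update_arrOf_set hl (by simp)]
  simp

/-! ### Running a program with a time limit -/

/-- `reg flag := if reg (r + K) = 0 then 0 else reg bud`. -/
def clockTest (K bud flag r : ℕ) : Prog :=
  .seq (.const flag 0) (.ite (r + K) (.op .or flag bud bud) .skip)

/-- `reg bud := reg bud - 1`. -/
def clockTick (bud flag : ℕ) : Prog :=
  .seq (.const flag 1) (.op .sub bud bud flag)

/-- The program `p`, working on the registers and arrays with numbers at least `K`, with all loops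
leaving as soon as the total number of iterations exceeds the contents of the register `bud`. -/
def Prog.clocked (K bud flag : ℕ) : Prog → Prog
  | .skip => .skip
  | .const r k => .const (r + K) k
  | .op o r a b => .op o (r + K) (a + K) (b + K)
  | .load r A i => .load (r + K) (A + K) (i + K)
  | .store A i r => .store (A + K) (i + K) (r + K)
  | .seq p q => .seq (p.clocked K bud flag) (q.clocked K bud flag)
  | .ite r p q => .ite (r + K) (p.clocked K bud flag) (q.clocked K bud flag)
  | .loop r p => .seq (clockTest K bud flag r)
      (.loop flag (.seq (clockTick bud flag)
        (.seq (p.clocked K bud flag) (clockTest K bud flag r))))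

/-- The number of steps of `p.clocked` per unit of the time limit. -/
def Prog.clockCost : Prog → ℕ
  | .seq p q => p.clockCost + q.clockCost
  | .ite _ p q => p.clockCost + q.clockCost + 1
  | .loop _ p => p.clockCost + 10
  | _ => 1

/-- The registers and arrays of `σ` from number `K` on are those of `s`. -/
def State.Embeds (K : ℕ) (s σ : State w) : Prop :=
  (∀ r, σ.reg (r + K) = s.reg r) ∧ ∀ A, σ.arr (A + K) = s.arr A

theorem State.Embeds.setReg {K : ℕ} {s σ : State w} (h : s.Embeds K σ) (r : ℕ) (x : BitVec w) :
    (s.setReg r x).Embeds K (σ.setReg (r + K) x) := by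
  refine ⟨fun r' => ?_, h.2⟩
  simp [h.1]

theorem State.Embeds.setReg_lt {K : ℕ} {s σ : State w} (h : s.Embeds K σ) {r : ℕ} (hr : r < K)
    (x : BitVec w) : s.Embeds K (σ.setReg r x) := by
  refine ⟨fun r' => ?_, h.2⟩
  have : r' + K ≠ r := by omega
  simp [h.1, this]

theorem State.Embeds.setArr {K : ℕ} {s σ : State w} (h : s.Embeds K σ) (A : ℕ) (i x : BitVec w) :
    (s.setArr A i x).Embeds K (σ.setArr (A + K) i x) := by
  refine ⟨h.1, fun A' => ?_⟩
  simp [h.2]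

section Clock

variable {K bud flag : ℕ}

@[simp] theorem State.setReg_setReg (s : State w) (r : ℕ) (x y : BitVec w) :
    (s.setReg r x).setReg r y = s.setReg r y := by
  simp [State.setReg]

theorem runs_clockTest (hf : flag < K) (hbf : bud ≠ flag) (r : ℕ) (σ : State w) :
    Runs (clockTest K bud flag r) σ 4 fun σ' =>
      σ' = σ.setReg flag (if σ.reg (r + K) = 0#w then 0#w else σ.reg bud) := by
  have h1 : r + K ≠ flag := by omega
  refine (Runs.of_loopFree (by simp [clockTest, Prog.LoopFree]) σ).mono (le_of_eq rfl) ?_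
  rintro _ rfl
  simp only [clockTest, Prog.run, State.reg_setReg, if_neg h1, if_neg hbf, eval_or_self]
  split_ifs <;> simp

theorem runs_clockTick (hbf : bud ≠ flag) {σ : State w} (hb : σ.reg bud ≠ 0#w) :
    Runs (clockTick bud flag) σ 2 fun σ' =>
      ∃ x : BitVec w, x.toNat + 1 = (σ.reg bud).toNat ∧
        σ' = (σ.setReg flag 1#w).setReg bud x := by
  refine (Runs.of_loopFree (by simp [clockTick, Prog.LoopFree]) σ).mono (le_of_eq rfl) ?_
  rintro _ rfl
  refine ⟨σ.reg bud - 1#w, ?_, ?_⟩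
  · have h0 : (σ.reg bud).toNat ≠ 0 := fun h => hb (BitVec.eq_of_toNat_eq (by simpa using h))
    have hlt := (σ.reg bud).isLt
    have h1 : 1 < 2 ^ w := by omega
    have := BitVec.toNat_sub (σ.reg bud) 1#w
    rw [this, BitVec.toNat_ofNat, Nat.mod_eq_of_lt h1,
      show 2 ^ w - 1 + (σ.reg bud).toNat = (σ.reg bud).toNat - 1 + 2 ^ w by omega,
      Nat.add_mod_right, Nat.mod_eq_of_lt (by omega)]
    omega
  · simp [clockTick, Prog.run, hbf, BinOp.eval]

/-- With an exhausted time limit a clocked program halts at once. -/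
theorem runs_clocked_of_bud_eq_zero (hb : bud < K) (hf : flag < K) (hbf : bud ≠ flag) (p : Prog)
    (σ : State w) (h : σ.reg bud = 0#w) :
    Runs (p.clocked K bud flag) σ p.clockCost fun σ' => σ'.reg bud = 0#w := by
  have hne : ∀ r, bud ≠ r + K := fun r => by omega
  induction p generalizing σ with
  | skip => exact ⟨_, _, .skip σ, le_rfl, h⟩
  | const r k => exact ⟨_, _, .const σ _ k, le_rfl, by simp [hne, h]⟩
  | op o r a b => exact ⟨_, _, .op σ o _ _ _, le_rfl, by simp [hne, h]⟩
  | load r A i => exact ⟨_, _, .load σ _ _ _, le_rfl, by simp [hne, h]⟩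
  | store A i r => exact ⟨_, _, .store σ _ _ _, le_rfl, by simp [h]⟩
  | seq p q ihp ihq => exact (ihp σ h).seq fun s' hs' => ihq s' hs'
  | ite r p q ihp ihq =>
    exact Runs.ite (fun _ => (ihp σ h).mono (Nat.le_add_right _ _) fun _ => id)
      (fun _ => (ihq σ h).mono (Nat.le_add_left _ _) fun _ => id)
  | loop r p =>
    have h2 : Runs (Prog.clocked K bud flag (.loop r p)) σ (4 + 1)
        fun σ' => σ'.reg bud = 0#w := by
      refine (runs_clockTest hf hbf r σ).seq ?_
      rintro _ rfl
      exact ⟨1, _, .loopDone (by simp [h]), le_rfl, by simp [hbf, h]⟩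
    exact h2.mono (by simp only [Prog.clockCost]; omega) fun _ => id

/-- A clocked program either exhausts its time limit or does what the original program does. -/
theorem Exec.clocked (hb : bud < K) (hf : flag < K) (hbf : bud ≠ flag) {p : Prog}
    {s s' : State w} {t : ℕ} (h : Exec p s t s') (σ : State w)
    (hσ : σ.reg bud = 0#w ∨ s.Embeds K σ) :
    ∃ t' σ', Exec (p.clocked K bud flag) σ t' σ' ∧
      t' + p.clockCost * (σ'.reg bud).toNat ≤ p.clockCost * (1 + (σ.reg bud).toNat) ∧
      (σ'.reg bud).toNat ≤ (σ.reg bud).toNat ∧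
      (σ.reg bud).toNat ≤ (σ'.reg bud).toNat + t ∧
      (σ'.reg bud = 0#w ∨ s'.Embeds K σ') := by
  -- The time bound is a potential argument with potential `clockCost` times the remaining budget.
  -- The budget falls by at most `t`, because every loop iteration of `p` costs a step of its own.
  -- Allowing an exhausted budget in place of `Embeds`, before and after, lets the induction
  -- continue past the cutoff.
  have hne : ∀ r, bud ≠ r + K := fun r => by omega
  induction h generalizing σ with
  | skip s => exact ⟨_, _, .skip σ, by simp [Prog.clockCost], le_rfl, by omega, hσ⟩
  | const s r k =>
    exact ⟨_, _, .const σ _ k, by simp [Prog.clockCost, hne], by simp [hne],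
      by simp [hne], hσ.imp (by simp [hne]) fun h => h.setReg _ _⟩
  | op s o r a b =>
    exact ⟨_, _, .op σ o _ _ _, by simp [Prog.clockCost, hne], by simp [hne],
      by simp [hne], hσ.imp (by simp [hne]) fun h => by simpa only [h.1] using h.setReg _ _⟩
  | load s r A i =>
    exact ⟨_, _, .load σ _ _ _, by simp [Prog.clockCost, hne], by simp [hne],
      by simp [hne], hσ.imp (by simp [hne]) fun h => by simpa only [h.1, h.2] using h.setReg _ _⟩
  | store s A i r =>
    exact ⟨_, _, .store σ _ _ _, by simp [Prog.clockCost], by simp,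
      by simp, hσ.imp (by simp) fun h => by simpa only [h.1] using h.setArr _ _ _⟩
  | @seq p q s₁ s₂ s₃ t₁ t₂ _ _ ih₁ ih₂ =>
    obtain ⟨u₁, σ₁, e₁, hu₁, hle₁, ht₁, h₁⟩ := ih₁ σ hσ
    obtain ⟨u₂, σ₂, e₂, hu₂, hle₂, ht₂, h₂⟩ := ih₂ σ₁ h₁
    refine ⟨_, σ₂, .seq e₁ e₂, ?_, by omega, by omega, h₂⟩
    simp only [Prog.clockCost]
    have := Nat.mul_le_mul_left p.clockCost hle₂
    have := Nat.mul_le_mul_left q.clockCost hle₁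
    linarith
  | @iteTrue r p q s s' t hr _ ih =>
    -- After the cutoff the tested register is unrelated to `s`, so either branch may be taken.
    by_cases h0 : σ.reg bud = 0#w
    · obtain ⟨u, σ', e, hu, h'⟩ :=
        runs_clocked_of_bud_eq_zero hb hf hbf (.ite r p q) σ h0
      exact ⟨u, σ', e, by simpa [h', h0] using hu, by simp [h'], by simp [h0], .inl h'⟩
    · have hE := hσ.resolve_left h0
      obtain ⟨u, σ', e, hu, hle, ht, h'⟩ := ih σ hσ
      refine ⟨_, σ', .iteTrue (by rwa [hE.1]) e, ?_, hle, by omega, h'⟩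
      simp only [Prog.clockCost]
      have := Nat.mul_le_mul_left q.clockCost hle
      linarith
  | @iteFalse r p q s s' t hr _ ih =>
    by_cases h0 : σ.reg bud = 0#w
    · obtain ⟨u, σ', e, hu, h'⟩ :=
        runs_clocked_of_bud_eq_zero hb hf hbf (.ite r p q) σ h0
      exact ⟨u, σ', e, by simpa [h', h0] using hu, by simp [h'], by simp [h0], .inl h'⟩
    · have hE := hσ.resolve_left h0
      obtain ⟨u, σ', e, hu, hle, ht, h'⟩ := ih σ hσ
      refine ⟨_, σ', .iteFalse (by rwa [hE.1]) e, ?_, hle, by omega, h'⟩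
      simp only [Prog.clockCost]
      have := Nat.mul_le_mul_left p.clockCost hle
      linarith
  | @loopDone r p s hr =>
    by_cases h0 : σ.reg bud = 0#w
    · obtain ⟨u, σ', e, hu, h'⟩ :=
        runs_clocked_of_bud_eq_zero hb hf hbf (.loop r p) σ h0
      exact ⟨u, σ', e, by simpa [h', h0] using hu, by simp [h'], by simp [h0], .inl h'⟩
    · have hE := hσ.resolve_left h0
      obtain ⟨u, σ', e, hu, rfl⟩ := runs_clockTest hf hbf r σ
      refine ⟨_, _, .seq e (.loopDone (by simp [hE.1, hr])), ?_, by simp [hbf], by simp [hbf],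
        .inr (hE.setReg_lt hf _)⟩
      simp only [Prog.clockCost, State.reg_setReg, if_neg hbf]
      rw [Nat.mul_add]
      omega
  | @loopStep r p s₁ s₂ s₃ t₁ t₂ hr _ _ ih₁ ih₂ =>
    by_cases h0 : σ.reg bud = 0#w
    · obtain ⟨u, σ', e, hu, h'⟩ :=
        runs_clocked_of_bud_eq_zero hb hf hbf (.loop r p) σ h0
      exact ⟨u, σ', e, by simpa [h', h0] using hu, by simp [h'], by simp [h0], .inl h'⟩
    · have hE := hσ.resolve_left h0
      obtain ⟨u₀, σ₀, e₀, hu₀, hσ₀⟩ := runs_clockTest hf hbf r σ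
      have hb₀ : σ₀.reg bud = σ.reg bud := by simp [hσ₀, hbf]
      have hE₀ : s₁.Embeds K σ₀ := hσ₀ ▸ hE.setReg_lt hf _
      obtain ⟨u₁, σ₁, e₁, hu₁, x, hx, hσ₁⟩ := runs_clockTick (σ := σ₀) hbf (by rwa [hb₀])
      have hb₁ : σ₁.reg bud = x := by simp [hσ₁]
      have hE₁ : s₁.Embeds K σ₁ := hσ₁ ▸ (hE₀.setReg_lt hf _).setReg_lt hb _
      obtain ⟨u₂, σ₂, e₂, hu₂, hle₂, ht₂, h₂⟩ := ih₁ σ₁ (.inr hE₁)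
      obtain ⟨u₃, σ₃, e₃, hu₃, hle₃, ht₃, h₃⟩ := ih₂ σ₂ h₂
      -- The clocked remainder of the loop starts with its own test. Regrouped, this test ends the
      -- body of the present iteration.
      obtain ⟨v₁, v₂, σ₄, hv, e₄, e₅⟩ : ∃ v₁ v₂ σ₄, u₃ = v₁ + v₂ ∧
          Exec (clockTest K bud flag r) σ₂ v₁ σ₄ ∧
          Exec (.loop flag (.seq (clockTick bud flag)
            (.seq (p.clocked K bud flag) (clockTest K bud flag r)))) σ₄ v₂ σ₃ := by
        cases e₃ with
        | seq e₄ e₅ => exact ⟨_, _, _, rfl, e₄, e₅⟩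
      subst hv
      refine ⟨_, σ₃, .seq e₀ (.loopStep ?_ (.seq e₁ (.seq e₂ e₄)) e₅), ?_, ?_, ?_, h₃⟩
      · simpa [hσ₀, hE.1, hr] using h0
      -- The overhead of an iteration is at most 4 + 2 + 1 steps outside the recursive runs; the 10
      -- in `clockCost`, released by the tick, covers it.
      · rw [hb₁] at hu₂ hle₂
        rw [hb₀] at hx
        simp only [Prog.clockCost] at hu₃ ⊢
        rw [← hx]
        generalize (σ₃.reg bud).toNat = b₃ at *
        generalize (σ₂.reg bud).toNat = b₂ at *
        nlinarith
      · rw [hb₁] at hle₂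
        rw [hb₀] at hx
        omega
      · rw [hb₁] at ht₂
        rw [hb₀] at hx
        omega

end Clock

end WordRAM

/-! ### Hypergraphs with a hyperedge that contains all vertices -/

namespace FinHypergraph

/-- The star with centre `c` is a join tree: `c` contains every vertex, so each induced subgraph is
again a star around `c`. -/
theorem isAcyclic_of_edge_eq_univ (H : FinHypergraph) {c : Fin H.m}
    (hc : H.edge c = Finset.univ) : H.IsAcyclic := by
  let S : SimpleGraph (Fin H.m) := SimpleGraph.fromRel fun _ y => y = c
  have hS : ∀ x, x ≠ c → S.Adj x c := fun x hx => by simp [S, hx]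
  have hreach : ∀ x, S.Reachable x c := fun x => by
    by_cases hx : x = c
    · rw [hx]
    · exact (hS x hx).reachable
  have hconn : S.Connected :=
    { preconnected := fun x y => (hreach x).trans (hreach y).symm
      nonempty := ⟨c⟩ }
  obtain ⟨T, hTS, hT⟩ := hconn.exists_isTree_le
  -- The first edge of a walk from `x` to `c` in `T` is an edge of the star, so it already ends in
  -- `c`. Hence the spanning tree is the whole star.
  have hadj : ∀ x, x ≠ c → T.Adj x c := fun x hx => by
    obtain ⟨p⟩ := hT.connected.preconnected x c
    cases p with
    | nil => exact absurd rfl hx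
    | @cons _ y _ h _ =>
      have : S.Adj x y := hTS h
      have hy : y = c := by simp [S, hx] at this; exact this.2
      rwa [← hy]
  refine ⟨T, hT, fun v => ?_⟩
  have hmem : c ∈ {e | v ∈ H.edge e} := by simp [hc]
  have key : ∀ x : {e | v ∈ H.edge e},
      (T.induce {e | v ∈ H.edge e}).Reachable x ⟨c, hmem⟩ := fun x => by
    by_cases hx : x.1 = c
    · rw [show x = ⟨c, hmem⟩ from Subtype.ext hx]
    · exact SimpleGraph.Adj.reachable (by simpa using hadj _ hx)
  exact fun x y => (key x).trans (key y).symm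

theorem connected_of_edge_eq_univ (H : FinHypergraph) {c : Fin H.m}
    (hc : H.edge c = Finset.univ) : H.incidenceGraph.Connected := by
  have hadj : ∀ v e, v ∈ H.edge e → H.incidenceGraph.Adj (Sum.inl v) (Sum.inr e) :=
    fun v e h => by simp [incidenceGraph, h]
  have hv : ∀ v, H.incidenceGraph.Reachable (Sum.inl v) (Sum.inr c) :=
    fun v => (hadj v c (by simp [hc])).reachable
  have key : ∀ x, H.incidenceGraph.Reachable x (Sum.inr c) := by
    rintro (v | e)
    · exact hv v
    · obtain ⟨v, h⟩ := H.edge_nonempty e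
      exact (hadj v e h).reachable.symm.trans (hv v)
  exact { preconnected := fun x y => (key x).trans (key y).symm, nonempty := ⟨Sum.inr c⟩ }

theorem size_le (H : FinHypergraph) : H.size ≤ H.m * H.n := by
  have := Finset.sum_le_card_nsmul Finset.univ (fun e => (H.edge e).card) H.n
    (fun e _ => (Finset.card_le_univ _).trans_eq (Fintype.card_fin _))
  simpa [size] using this

theorem size_pos (H : FinHypergraph) (e : Fin H.m) : 0 < H.size :=
  Finset.sum_pos (fun e _ => (H.edge_nonempty e).card_pos) ⟨e, Finset.mem_univ e⟩

end FinHypergraph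

/-! ### The hypergraph of a formula -/

namespace CNFFormula

/-- Variables below `half` are assigned by the first kind of hyperedges, the others by the
second kind. -/
def half (φ : CNFFormula) : ℕ := φ.numVars / 2 + 1

/-- The hyperedges `e < 2 ^ h` assign truth values to the variables below `h`, those with
`2 ^ h ≤ e < 2 * 2 ^ h` to the variables `x` with `h ≤ x < 2 * h`. The literal with code `l` is
true at `e` if its variable is assigned by `e` in the right way. -/
def litTrue (h e l : ℕ) : Bool :=
  decide (l / 2 / h = e / 2 ^ h) && decide (e / 2 ^ (l / 2 % h) % 2 = l % 2)

/-- This agrees with `encode` and is also the offset of the literal among the literal vertices. -/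
def litCode {n : ℕ} (l : Fin n × Bool) : ℕ := 2 * (l.1 : ℕ) + l.2.toNat

def clauseTrue (φ : CNFFormula) (e : ℕ) (c : List (Fin φ.numVars × Bool)) : Bool :=
  c.any fun l => litTrue φ.half e (litCode l)

/-- Incidence of the hyperedge `e` and the vertex `v`. The vertices are the clauses, followed by
all literals of `2 * half` variables. -/
def incident (φ : CNFFormula) (e v : ℕ) : Bool :=
  if v < φ.clauses.length then
    decide (e / 2 ^ φ.half = 1) == φ.clauseTrue e (φ.clauses.getD v [])
  else
    decide ((v - φ.clauses.length) / 2 / φ.half < e / 2 ^ φ.half) ||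
      litTrue φ.half e (v - φ.clauses.length)

theorem half_pos (φ : CNFFormula) : 0 < φ.half := Nat.succ_pos _

theorem numVars_lt (φ : CNFFormula) : φ.numVars < 2 * φ.half := by
  unfold half; omega

@[simp] theorem litCode_div {n : ℕ} (l : Fin n × Bool) : litCode l / 2 = l.1 := by
  have := Bool.toNat_lt l.2
  unfold litCode; omega

@[simp] theorem litCode_mod {n : ℕ} (l : Fin n × Bool) : litCode l % 2 = l.2.toNat := by
  have := Bool.toNat_lt l.2
  unfold litCode; omega

theorem div_mod_two_eq_toNat_iff (e i : ℕ) (b : Bool) :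
    e / 2 ^ i % 2 = b.toNat ↔ e.testBit i = b := by
  rw [Nat.testBit_eq_decide_div_mod_eq]
  have := Nat.mod_two_eq_zero_or_one (e / 2 ^ i)
  cases b <;> simp

theorem litTrue_iff {h e l x : ℕ} {b : Bool} (hx : l / 2 = x) (hb : l % 2 = b.toNat) :
    litTrue h e l = true ↔ x / h = e / 2 ^ h ∧ e.testBit (x % h) = b := by
  simp [litTrue, hx, hb, div_mod_two_eq_toNat_iff]

theorem incident_lit (φ : CNFFormula) (e x : ℕ) (b : Bool) :
    φ.incident e (φ.clauses.length + (2 * x + b.toNat)) = true ↔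
      x / φ.half < e / 2 ^ φ.half ∨
        x / φ.half = e / 2 ^ φ.half ∧ e.testBit (x % φ.half) = b := by
  have := Bool.toNat_lt b
  simp only [incident, Nat.not_lt.2 (Nat.le_add_right φ.clauses.length _), if_false,
    Nat.add_sub_cancel_left, Bool.or_eq_true, decide_eq_true_eq]
  rw [litTrue_iff (x := x) (b := b) (by omega) (by omega),
    show (2 * x + b.toNat) / 2 = x by omega]

theorem lit_lt (φ : CNFFormula) {x : ℕ} (hx : x < 2 * φ.half) (b : Bool) :
    φ.clauses.length + (2 * x + b.toNat) < φ.clauses.length + 4 * φ.half := by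
  have := Bool.toNat_lt b
  omega

/-- The hyperedges `e` and `f` of the first and second kind form a satisfying assignment if and
only if `e` is a subset of `f`. -/
def subsetHypergraph (φ : CNFFormula) : FinHypergraph where
  n := φ.clauses.length + 4 * φ.half
  m := 2 * 2 ^ φ.half + 1
  edge e := Finset.univ.filter fun v => φ.incident e v = true
  edge_nonempty e := by
    -- Variable 0 lies on side 0: its literal with the value of bit 0 is true at `e` on side 0, and
    -- higher sides contain all literals of side 0.
    refine ⟨⟨_, φ.lit_lt (x := 0) (by have := φ.half_pos; omega) ((e : ℕ).testBit 0)⟩, ?_⟩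
    simp only [Finset.mem_filter, Finset.mem_univ, true_and]
    rw [incident_lit]
    simp only [Nat.zero_div, Nat.zero_mod, and_true]
    exact (Nat.eq_zero_or_pos _).symm.imp_right Eq.symm

theorem mem_edge (φ : CNFFormula) (e : Fin φ.subsetHypergraph.m) (v : Fin φ.subsetHypergraph.n) :
    v ∈ φ.subsetHypergraph.edge e ↔ φ.incident e v = true :=
  Finset.mem_filter.trans (and_iff_right (Finset.mem_univ _))

theorem edge_subset_iff (φ : CNFFormula) (e f : Fin φ.subsetHypergraph.m) :
    φ.subsetHypergraph.edge e ⊆ φ.subsetHypergraph.edge f ↔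
      ∀ v < φ.clauses.length + 4 * φ.half, φ.incident e v = true → φ.incident f v = true := by
  constructor
  · intro h v hv he
    exact (φ.mem_edge f ⟨v, hv⟩).1 (h ((φ.mem_edge e ⟨v, hv⟩).2 he))
  · intro h v hv
    exact (φ.mem_edge f v).2 (h v v.2 ((φ.mem_edge e v).1 hv))

theorem clauseTrue_iff (φ : CNFFormula) (e : ℕ) (c : List (Fin φ.numVars × Bool)) :
    φ.clauseTrue e c = true ↔ ∃ l ∈ c, (l.1 : ℕ) / φ.half = e / 2 ^ φ.half ∧
      e.testBit (l.1 % φ.half) = l.2 := by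
  simp only [clauseTrue, List.any_eq_true]
  refine exists_congr fun l => and_congr_right fun _ => ?_
  exact litTrue_iff (litCode_div l) (litCode_mod l)

theorem side_le_one (φ : CNFFormula) {x : ℕ} (hx : x < 2 * φ.half) : x / φ.half ≤ 1 := by
  rw [← Nat.lt_succ_iff, Nat.div_lt_iff_lt_mul φ.half_pos]; omega

theorem side_last (φ : CNFFormula) : 2 * 2 ^ φ.half / 2 ^ φ.half = 2 :=
  Nat.mul_div_cancel _ (by positivity)

/-- The index 2 * 2^h has side 2. No variable lives there, so it satisfies no clause and, not being
of side 1, contains all of them; all literals have a lower side. -/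
theorem incident_last (φ : CNFFormula) {v : ℕ} (hv : v < φ.clauses.length + 4 * φ.half) :
    φ.incident (2 * 2 ^ φ.half) v = true := by
  unfold incident
  rw [side_last]
  split_ifs with h
  · have : φ.clauseTrue (2 * 2 ^ φ.half) (φ.clauses.getD v []) = false := by
      rw [Bool.eq_false_iff, Ne, clauseTrue_iff, side_last]
      rintro ⟨l, _, h2, _⟩
      have := φ.side_le_one (l.1.2.trans φ.numVars_lt)
      omega
    rw [this]; rfl
  · have := φ.side_le_one (x := (v - φ.clauses.length) / 2) (by omega)
    simp only [Bool.or_eq_true, decide_eq_true_eq]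
    omega

/-- The hyperedge that contains all vertices. -/
def lastEdge (φ : CNFFormula) : Fin φ.subsetHypergraph.m := Fin.last _

theorem edge_lastEdge (φ : CNFFormula) : φ.subsetHypergraph.edge φ.lastEdge = Finset.univ := by
  ext v
  exact ⟨fun _ => Finset.mem_univ _, fun _ => (φ.mem_edge _ _).2 (φ.incident_last v.2)⟩

/-- Each side is an antichain: for every variable of the side exactly one literal is present, so an
inclusion forces all bits to agree. -/
theorem eq_of_incident_imp (φ : CNFFormula) {e f : ℕ} (he : e / 2 ^ φ.half ≤ 1)
    (hf : f / 2 ^ φ.half = e / 2 ^ φ.half)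
    (h : ∀ v < φ.clauses.length + 4 * φ.half, φ.incident e v = true → φ.incident f v = true) :
    e = f := by
  have hmod : e % 2 ^ φ.half = f % 2 ^ φ.half := by
    refine Nat.eq_of_testBit_eq fun i => ?_
    rw [Nat.testBit_mod_two_pow, Nat.testBit_mod_two_pow]
    by_cases hi : i < φ.half
    · have hx : (e / 2 ^ φ.half) * φ.half + i < 2 * φ.half := by nlinarith
      have hdiv : ((e / 2 ^ φ.half) * φ.half + i) / φ.half = e / 2 ^ φ.half := by
        rw [Nat.mul_comm, Nat.mul_add_div φ.half_pos, Nat.div_eq_of_lt hi, Nat.add_zero]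
      have hm : ((e / 2 ^ φ.half) * φ.half + i) % φ.half = i := by
        rw [Nat.mul_comm, Nat.mul_add_mod, Nat.mod_eq_of_lt hi]
      have := h _ (φ.lit_lt hx (e.testBit i))
      rw [incident_lit, incident_lit, hdiv, hm, hf] at this
      have := (this (.inr ⟨rfl, rfl⟩)).resolve_left (lt_irrefl _)
      simp [hi, this.2]
    · simp [hi]
  rw [← Nat.div_add_mod e (2 ^ φ.half), ← Nat.div_add_mod f (2 ^ φ.half), hf, hmod]

/-- Inclusions never lead to a lower side. The witness is a literal of the variable `half`, the
first one of side 1. -/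
theorem exists_incident_of_lt (φ : CNFFormula) {e f : ℕ} (hlt : f / 2 ^ φ.half < e / 2 ^ φ.half)
    (he : e / 2 ^ φ.half ≤ 2) :
    ∃ v < φ.clauses.length + 4 * φ.half, φ.incident e v = true ∧ φ.incident f v = false := by
  have h1 : φ.half / φ.half = 1 := Nat.div_self φ.half_pos
  have hx : φ.half < 2 * φ.half := by have := φ.half_pos; omega
  by_cases he1 : e / 2 ^ φ.half = 1
  · refine ⟨_, φ.lit_lt hx (e.testBit 0), ?_, ?_⟩
    · rw [incident_lit, h1, Nat.mod_self]; simp [he1]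
    · rw [Bool.eq_false_iff, Ne, incident_lit, h1]; omega
  -- Here `e` has side 2 and contains both literals of this variable, while `f` misses the one with
  -- the value opposite to its bit 0, whether its side is 0 or 1.
  · refine ⟨_, φ.lit_lt hx (!f.testBit 0), ?_, ?_⟩
    · rw [incident_lit, h1]
      generalize e / 2 ^ φ.half = a at *
      generalize f / 2 ^ φ.half = b at *
      omega
    · rw [Bool.eq_false_iff, Ne, incident_lit, h1, Nat.mod_self]
      rintro (h | ⟨_, h⟩)
      · omega
      · simp at h

/-- At a clause the implication reads: if `e` fails it, then `f` satisfies it. Literal vertices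
impose nothing, since `e` has only literals of side 0 and `f` has all of these. -/
theorem incident_imp_iff (φ : CNFFormula) {e f : ℕ} (he : e / 2 ^ φ.half = 0)
    (hf : f / 2 ^ φ.half = 1) :
    (∀ v < φ.clauses.length + 4 * φ.half, φ.incident e v = true → φ.incident f v = true) ↔
      ∀ c ∈ φ.clauses, φ.clauseTrue e c = true ∨ φ.clauseTrue f c = true := by
  have hcl : ∀ v (hv : v < φ.clauses.length),
      ((φ.incident e v = true → φ.incident f v = true) ↔
        (φ.clauseTrue e φ.clauses[v] = true ∨ φ.clauseTrue f φ.clauses[v] = true)) := by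
    intro v hv
    simp only [incident, if_pos hv, he, hf, List.getD_eq_getElem _ _ hv]
    cases φ.clauseTrue e φ.clauses[v] <;> cases φ.clauseTrue f φ.clauses[v] <;> simp
  constructor
  · intro h c hc
    obtain ⟨v, hv, rfl⟩ := List.mem_iff_getElem.1 hc
    exact (hcl v hv).1 (h v (by omega))
  · intro h v hv hev
    by_cases hvc : v < φ.clauses.length
    · exact (hcl v hvc).2 (h _ (List.getElem_mem _)) hev
    · simp only [incident, if_neg hvc, he, hf, litTrue] at hev ⊢
      simp only [Nat.not_lt_zero, decide_false, Bool.false_or, Bool.and_eq_true,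
        decide_eq_true_eq] at hev
      simp [hev.1]

theorem satisfiable_iff (φ : CNFFormula) :
    φ.Satisfiable ↔ ∃ e f, e / 2 ^ φ.half = 0 ∧ f / 2 ^ φ.half = 1 ∧
      ∀ c ∈ φ.clauses, φ.clauseTrue e c = true ∨ φ.clauseTrue f c = true := by
  have hpos : 0 < 2 ^ φ.half := by positivity
  have side : ∀ x, x < φ.numVars →
      x / φ.half = 0 ∧ x % φ.half = x ∧ x < φ.half ∨
      x / φ.half = 1 ∧ x % φ.half = x - φ.half ∧ φ.half ≤ x ∧ x - φ.half < φ.half := by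
    intro x hx
    have := φ.numVars_lt
    by_cases h : x < φ.half
    · exact .inl ⟨Nat.div_eq_of_lt h, Nat.mod_eq_of_lt h, h⟩
    · have h2 : x - φ.half < φ.half := by omega
      refine .inr ⟨?_, ?_, by omega, h2⟩
      · rw [Nat.div_eq_of_lt_le] <;> omega
      · rw [Nat.mod_eq_sub_mod (by omega), Nat.mod_eq_of_lt h2]
  constructor
  · rintro ⟨a, ha⟩
    -- Since `numVars` is below 2 * `half`, some padding variables occur in no clause; their value
    -- is arbitrary.
    let g : ℕ → Bool := fun x => if hx : x < φ.numVars then a ⟨x, hx⟩ else false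
    let E := Nat.ofBits fun i : Fin φ.half => g i
    let F := Nat.ofBits fun i : Fin φ.half => g (i + φ.half)
    have hE : E < 2 ^ φ.half := Nat.ofBits_lt_two_pow _
    have hF : F < 2 ^ φ.half := Nat.ofBits_lt_two_pow _
    have hF1 : (2 ^ φ.half + F) / 2 ^ φ.half = 1 := by
      rw [Nat.add_div_left _ hpos, Nat.div_eq_of_lt hF]
    refine ⟨E, 2 ^ φ.half + F, Nat.div_eq_of_lt hE, hF1, fun c hc => ?_⟩
    obtain ⟨l, hl, hal⟩ := ha c hc
    rw [clauseTrue_iff, clauseTrue_iff, hF1, Nat.div_eq_of_lt hE]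
    rcases side l.1 l.1.2 with ⟨h1, h2, h3⟩ | ⟨h1, h2, h3, h4⟩
    · refine .inl ⟨l, hl, h1, ?_⟩
      rw [h2, Nat.testBit_ofBits_lt _ _ h3]
      simp [g, hal]
    · refine .inr ⟨l, hl, h1, ?_⟩
      rw [h2, Nat.testBit_two_pow_add_gt h4, Nat.testBit_ofBits_lt _ _ h4]
      simp [g, Nat.sub_add_cancel h3, hal]
  · rintro ⟨e, f, he, hf, h⟩
    refine ⟨fun x => if (x : ℕ) / φ.half = 0 then e.testBit (x % φ.half)
      else f.testBit (x % φ.half), fun c hc => ?_⟩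
    rcases h c hc with h | h <;> obtain ⟨l, hl, h1, h2⟩ := (φ.clauseTrue_iff _ _).1 h
    · exact ⟨l, hl, by simp only [h1, he, if_true, h2]⟩
    · exact ⟨l, hl, by simp only [h1, hf, h2]; simp⟩

theorem side_lt_two (φ : CNFFormula) {e : Fin φ.subsetHypergraph.m} (he : e ≠ φ.lastEdge) :
    (e : ℕ) / 2 ^ φ.half < 2 := by
  have h1 : (e : ℕ) < 2 * 2 ^ φ.half + 1 := e.2
  have h2 : (e : ℕ) ≠ 2 * 2 ^ φ.half := fun h => he (Fin.ext h)
  rw [Nat.div_lt_iff_lt_mul (by positivity)]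
  omega

theorem side_lastEdge (φ : CNFFormula) : (φ.lastEdge : ℕ) / 2 ^ φ.half = 2 := φ.side_last

/-- Comparing the sides of `e` and `f`, only a step from side 0 to side 1 survives among the
hyperedges other than the full one. -/
theorem adj_iff (φ : CNFFormula) (e f : Fin φ.subsetHypergraph.m) :
    φ.subsetHypergraph.subsetGraph.Adj e f ↔ (e ≠ φ.lastEdge ∧ f = φ.lastEdge) ∨
      ((e : ℕ) / 2 ^ φ.half = 0 ∧ (f : ℕ) / 2 ^ φ.half = 1 ∧
        ∀ c ∈ φ.clauses, φ.clauseTrue e c = true ∨ φ.clauseTrue f c = true) := by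
  change e ≠ f ∧ φ.subsetHypergraph.edge e ⊆ φ.subsetHypergraph.edge f ↔ _
  by_cases hf : f = φ.lastEdge
  · subst hf
    rw [edge_lastEdge, side_lastEdge]
    simp
  · rw [edge_subset_iff]
    have hf2 := φ.side_lt_two hf
    have he2 : (e : ℕ) / 2 ^ φ.half ≤ 2 := by
      by_cases he : e = φ.lastEdge
      · rw [he, side_lastEdge]
      · exact (φ.side_lt_two he).le
    simp only [hf, and_false, false_or]
    constructor
    · rintro ⟨hne, h⟩
      rcases lt_trichotomy ((e : ℕ) / 2 ^ φ.half) ((f : ℕ) / 2 ^ φ.half) with h3 | h3 | h3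
      · have h4 : (e : ℕ) / 2 ^ φ.half = 0 := Nat.lt_one_iff.1 (by omega)
        have h5 : (f : ℕ) / 2 ^ φ.half = 1 := by omega
        exact ⟨h4, h5, (φ.incident_imp_iff h4 h5).1 h⟩
      · exact absurd (Fin.ext (φ.eq_of_incident_imp (by omega) h3.symm h)) hne
      · obtain ⟨v, hv, h6, h7⟩ := φ.exists_incident_of_lt h3 he2
        rw [h v hv h6] at h7
        cases h7
    · rintro ⟨h4, h5, h⟩
      refine ⟨?_, (φ.incident_imp_iff h4 h5).2 h⟩
      rintro rfl
      omega

open Classical in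
/-- The edges of the subset graph that end in the hyperedge with all vertices. -/
noncomputable def trivialAdj (φ : CNFFormula) :
    Finset (Fin φ.subsetHypergraph.m × Fin φ.subsetHypergraph.m) :=
  (Finset.univ.erase φ.lastEdge).image fun e => (e, φ.lastEdge)

theorem card_trivialAdj (φ : CNFFormula) : φ.trivialAdj.card = 2 * 2 ^ φ.half := by
  classical
  rw [trivialAdj, Finset.card_image_of_injective _ fun a b h => (Prod.ext_iff.1 h).1,
    Finset.card_erase_of_mem (Finset.mem_univ _), Finset.card_univ, Fintype.card_fin]
  rfl

theorem mem_trivialAdj (φ : CNFFormula) (e f : Fin φ.subsetHypergraph.m) :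
    (e, f) ∈ φ.trivialAdj ↔ e ≠ φ.lastEdge ∧ f = φ.lastEdge := by
  classical
  simp [trivialAdj, eq_comm]

/-- The number of edges of the subset graph tells whether the formula is satisfiable. -/
theorem length_eq_iff (φ : CNFFormula)
    {l : List (Fin φ.subsetHypergraph.m × Fin φ.subsetHypergraph.m)} (hl : l.Nodup)
    (h : ∀ u v, (u, v) ∈ l ↔ φ.subsetHypergraph.subsetGraph.Adj u v) :
    l.length = 2 * 2 ^ φ.half ↔ ¬ φ.Satisfiable := by
  classical
  rw [← List.toFinset_card_of_nodup hl, ← card_trivialAdj]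
  have hsub : φ.trivialAdj ⊆ l.toFinset := by
    rintro ⟨e, f⟩ hef
    rw [List.mem_toFinset, h, adj_iff]
    exact .inl ((φ.mem_trivialAdj e f).1 hef)
  rw [satisfiable_iff]
  constructor
  · rintro hcard ⟨e, f, he, hf, hc⟩
    have heq := Finset.eq_of_subset_of_card_le hsub hcard.le
    have hpos : 0 < 2 ^ φ.half := by positivity
    have hf' : f < 2 * 2 ^ φ.half := by
      have : f / 2 ^ φ.half < 2 := by omega
      rwa [Nat.div_lt_iff_lt_mul hpos] at this
    have he' : e < 2 ^ φ.half := by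
      have : e / 2 ^ φ.half < 1 := by omega
      rwa [Nat.div_lt_iff_lt_mul hpos, one_mul] at this
    let e' : Fin φ.subsetHypergraph.m :=
      ⟨e, by change e < 2 * 2 ^ φ.half + 1; omega⟩
    let f' : Fin φ.subsetHypergraph.m :=
      ⟨f, by change f < 2 * 2 ^ φ.half + 1; omega⟩
    have : (e', f') ∈ φ.trivialAdj := by
      rw [heq, List.mem_toFinset, h, adj_iff]
      exact .inr ⟨he, hf, hc⟩
    have hlast := ((φ.mem_trivialAdj _ _).1 this).2
    have : f = 2 * 2 ^ φ.half := congrArg Fin.val hlast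
    omega
  · intro hns
    congr 1
    refine Finset.Subset.antisymm ?_ hsub
    rintro ⟨e, f⟩ hef
    rw [List.mem_toFinset, h, adj_iff] at hef
    rw [mem_trivialAdj]
    exact hef.resolve_right fun h' => hns ⟨e, f, h'⟩

theorem hasSparseSubsetGraph (φ : CNFFormula) (h : ¬ φ.Satisfiable) :
    φ.subsetHypergraph.HasSparseSubsetGraph := by
  have : {p : Fin φ.subsetHypergraph.m × Fin φ.subsetHypergraph.m |
      φ.subsetHypergraph.subsetGraph.Adj p.1 p.2} = φ.trivialAdj := by
    ext ⟨e, f⟩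
    rw [Finset.mem_coe, mem_trivialAdj, Set.mem_ofPred_eq, adj_iff]
    refine or_iff_left fun h' => h ?_
    exact φ.satisfiable_iff.2 ⟨e, f, h'⟩
  rw [FinHypergraph.HasSparseSubsetGraph, this, Set.ncard_coe_finset, card_trivialAdj]
  exact Nat.le_succ _

/-! ### The encoding of the hypergraph as a list grown by vertices and hyperedges. -/

/-- The vertices of the hyperedge `e` with numbers below `k`. -/
def vertexList (φ : CNFFormula) (e k : ℕ) : List ℕ := (List.range k).filter (φ.incident e)

/-- The encoding of the first `k` hyperedges. -/
def edgeCodes (φ : CNFFormula) (k : ℕ) : List ℕ :=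
  (List.range k).flatMap fun e =>
    (φ.vertexList e (φ.clauses.length + 4 * φ.half)).length ::
      φ.vertexList e (φ.clauses.length + 4 * φ.half)

theorem encode_subsetHypergraph (φ : CNFFormula) :
    φ.subsetHypergraph.encode = (φ.clauses.length + 4 * φ.half) :: (2 * 2 ^ φ.half + 1) ::
      φ.edgeCodes (2 * 2 ^ φ.half + 1) := by
  have hv : ∀ e : Fin φ.subsetHypergraph.m,
      ((List.finRange φ.subsetHypergraph.n).filter (· ∈ φ.subsetHypergraph.edge e)).map Fin.val =
        φ.vertexList e (φ.clauses.length + 4 * φ.half) := by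
    intro e
    rw [vertexList, ← List.map_coe_finRange_eq_range, List.filter_map]
    congr 1
    refine List.filter_congr fun v _ => ?_
    rw [Bool.eq_iff_iff, decide_eq_true_eq]
    exact φ.mem_edge e v
  have hc : ∀ e : Fin φ.subsetHypergraph.m, (φ.subsetHypergraph.edge e).card =
      (φ.vertexList e (φ.clauses.length + 4 * φ.half)).length := by
    intro e
    rw [← hv, List.length_map, ← List.toFinset_card_of_nodup ((List.nodup_finRange _).filter _)]
    congr 1
    ext v
    simp
  rw [FinHypergraph.encode]
  simp only [hv, hc]
  rw [edgeCodes, ← List.map_coe_finRange_eq_range, List.flatMap_map]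
  rfl

theorem length_vertexList_le (φ : CNFFormula) (e k : ℕ) : (φ.vertexList e k).length ≤ k :=
  (List.length_filter_le _ _).trans_eq List.length_range

theorem vertexList_succ (φ : CNFFormula) (e k : ℕ) : φ.vertexList e (k + 1) =
    if φ.incident e k = true then φ.vertexList e k ++ [k] else φ.vertexList e k := by
  rw [vertexList, List.range_succ, List.filter_append]
  split_ifs with h <;> simp [h, vertexList]

theorem edgeCodes_succ (φ : CNFFormula) (k : ℕ) : φ.edgeCodes (k + 1) = φ.edgeCodes k ++
    (φ.vertexList k (φ.clauses.length + 4 * φ.half)).length ::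
      φ.vertexList k (φ.clauses.length + 4 * φ.half) := by
  simp [edgeCodes, List.range_succ]

theorem length_edgeCodes_le (φ : CNFFormula) (k : ℕ) :
    (φ.edgeCodes k).length ≤ k * (φ.clauses.length + 4 * φ.half + 1) := by
  induction k with
  | zero => simp [edgeCodes]
  | succ k ih =>
    rw [edgeCodes_succ, List.length_append, List.length_cons, Nat.succ_mul k]
    exact Nat.add_le_add ih (Nat.succ_le_succ (φ.length_vertexList_le _ _))

end CNFFormula

/-! ### A program that writes the hypergraph of a formula -/

namespace WordRAM

open CNFFormula

variable {w : ℕ}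

/-- The closing `skip` costs a step, so a list of k elementary instructions takes k + 1 steps. -/
def Prog.block : List Prog → Prog
  | [] => .skip
  | p :: ps => .seq p (Prog.block ps)

/-- `reg 15 := litTrue h e l` and `reg 22 := l / 2 / h` for `h`, `e`, `l` in the registers `2`, `7`
and `14`, if the register `13` contains `e / 2 ^ h`. -/
def litProg : Prog := .block
  [.op .div 21 14 20, .op .div 22 21 2, .op .eq 15 22 13, .op .mod 23 21 2, .op .shr 23 7 23,
    .op .mod 23 23 20, .op .mod 21 14 20, .op .eq 23 23 21, .op .and 15 15 23]

theorem runs_litProg {h e l : ℕ} (hw : 2 < 2 ^ w) (hh : h < 2 ^ w) (he : e < 2 ^ w)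
    (hl : l < 2 ^ w) {s : State w} (s2 : s.reg 2 = BitVec.ofNat w h)
    (s7 : s.reg 7 = BitVec.ofNat w e) (s13 : s.reg 13 = BitVec.ofNat w (e / 2 ^ h))
    (s14 : s.reg 14 = BitVec.ofNat w l) (s20 : s.reg 20 = BitVec.ofNat w 2) :
    Runs litProg s 10 fun s' => s'.reg 15 = BitVec.ofNat w (litTrue h e l).toNat ∧
      s'.reg 22 = BitVec.ofNat w (l / 2 / h) := by
  refine (Runs.of_loopFree (by simp [litProg, Prog.block, Prog.LoopFree]) s).mono
    (le_of_eq rfl) ?_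
  rintro _ rfl
  have hl2 : l / 2 < 2 ^ w := (Nat.div_le_self _ _).trans_lt hl
  have hlh : l / 2 / h < 2 ^ w := (Nat.div_le_self _ _).trans_lt hl2
  have heh : e / 2 ^ h < 2 ^ w := (Nat.div_le_self _ _).trans_lt he
  have hm : l / 2 % h < 2 ^ w := (Nat.mod_le _ _).trans_lt hl2
  have hb : e / 2 ^ (l / 2 % h) < 2 ^ w := (Nat.div_le_self _ _).trans_lt he
  have hb2 : e / 2 ^ (l / 2 % h) % 2 < 2 ^ w := (Nat.mod_le _ _).trans_lt hb
  have hl3 : l % 2 < 2 ^ w := (Nat.mod_le _ _).trans_lt hl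
  simp [litProg, Prog.block, Prog.run, s2, s7, s13, s14, s20, eval_div hl hw, eval_div hl2 hh,
    eval_eq hlh heh, eval_mod hl2 hh, eval_shr he hm, eval_mod hb hw, eval_mod hl hw,
    eval_eq hb2 hl3, eval_and_bool, litTrue]

/-- The registers and the array that the program does not change after its first steps. -/
structure Prepared (φ : CNFFormula) (s : State w) : Prop where
  reg1 : s.reg 1 = BitVec.ofNat w φ.clauses.length
  reg2 : s.reg 2 = BitVec.ofNat w φ.half
  reg3 : s.reg 3 = BitVec.ofNat w (2 ^ φ.half)
  reg4 : s.reg 4 = BitVec.ofNat w (2 * 2 ^ φ.half + 1)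
  reg5 : s.reg 5 = BitVec.ofNat w (φ.clauses.length + 4 * φ.half)
  reg19 : s.reg 19 = BitVec.ofNat w 1
  reg20 : s.reg 20 = BitVec.ofNat w 2
  arr0 : s.arr 0 = arrOf w φ.encode

theorem Prepared.frame {φ : CNFFormula} {s s' : State w} {p : Prog} (h : Prepared φ s)
    (hp : ∀ r ∈ [1, 2, 3, 4, 5, 19, 20], ¬ p.WritesReg r) (hA : ¬ p.WritesArr 0)
    (hr : ∀ r, ¬ p.WritesReg r → s'.reg r = s.reg r)
    (ha : ∀ A, ¬ p.WritesArr A → s'.arr A = s.arr A) : Prepared φ s' where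
  reg1 := by rw [hr 1 (hp 1 (by simp)), h.reg1]
  reg2 := by rw [hr 2 (hp 2 (by simp)), h.reg2]
  reg3 := by rw [hr 3 (hp 3 (by simp)), h.reg3]
  reg4 := by rw [hr 4 (hp 4 (by simp)), h.reg4]
  reg5 := by rw [hr 5 (hp 5 (by simp)), h.reg5]
  reg19 := by rw [hr 19 (hp 19 (by simp)), h.reg19]
  reg20 := by rw [hr 20 (hp 20 (by simp)), h.reg20]
  arr0 := by rw [ha 0 hA, h.arr0]

/-- The words are long enough for all numbers that the program computes. -/
structure Fits (φ : CNFFormula) (w : ℕ) : Prop where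
  hypergraph : 2 + (2 * 2 ^ φ.half + 1) * (φ.clauses.length + 4 * φ.half + 1) < 2 ^ w
  formula : φ.encode.length < 2 ^ w

theorem Fits.edges {φ : CNFFormula} (hw : Fits φ w) : 2 * 2 ^ φ.half + 1 < 2 ^ w := by
  have h := hw.hypergraph
  have := Nat.le_mul_of_pos_right (2 * 2 ^ φ.half + 1)
    (Nat.succ_pos (φ.clauses.length + 4 * φ.half))
  exact (this.trans (Nat.le_add_left _ 2)).trans_lt h

theorem Fits.vertices {φ : CNFFormula} (hw : Fits φ w) :
    φ.clauses.length + 4 * φ.half < 2 ^ w := by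
  have h := hw.hypergraph
  have := Nat.le_mul_of_pos_left (φ.clauses.length + 4 * φ.half + 1)
    (Nat.succ_pos (2 * 2 ^ φ.half))
  exact ((Nat.le_succ _).trans (this.trans (Nat.le_add_left _ 2))).trans_lt h

theorem Fits.two {φ : CNFFormula} (hw : Fits φ w) : 2 < 2 ^ w := by
  have := hw.edges
  have : 0 < 2 ^ φ.half := by positivity
  omega

theorem Fits.pos {φ : CNFFormula} (hw : Fits φ w) : 0 < w := by
  rcases Nat.eq_zero_or_pos w with rfl | h
  · have := hw.two
    omega
  · exact h

theorem Fits.half {φ : CNFFormula} (hw : Fits φ w) : φ.half < 2 ^ w := by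
  have := hw.vertices
  omega

theorem Fits.litCode {φ : CNFFormula} (hw : Fits φ w) (l : Fin φ.numVars × Bool) :
    litCode l < 2 ^ w := by
  have h1 := hw.vertices
  have h2 := φ.numVars_lt
  have h3 := l.1.2
  have h4 := Bool.toNat_lt l.2
  unfold CNFFormula.litCode
  omega

/-- `reg 16 := reg 16 ∨ litTrue h e l` for the next literal `l`. -/
def literalStep : Prog :=
  .seq (.block [.load 14 0 11, .op .add 11 11 19])
    (.seq litProg (.block [.op .or 16 16 15, .op .sub 17 17 19]))

/-- `reg 18 := incident e v` for the next clause `v`. -/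
def clauseProg : Prog :=
  .seq (.block [.load 17 0 11, .op .add 11 11 19, .const 16 0])
    (.seq (.loop 17 literalStep) (.block [.op .eq 18 13 19, .op .eq 18 18 16]))

theorem lt_of_drop_eq_cons {l l' : List ℕ} {i x : ℕ} (h : l.drop i = x :: l') : i < l.length := by
  by_contra hi
  rw [List.drop_eq_nil_of_le (by omega)] at h
  cases h

/-- The invariant of the loop over the literals of a clause. -/
def LiteralInv (φ : CNFFormula) (e : ℕ) (c : List (Fin φ.numVars × Bool)) (tail : List ℕ)
    (k : ℕ) (s : State w) : Prop :=
  Prepared φ s ∧ s.reg 7 = BitVec.ofNat w e ∧ s.reg 13 = BitVec.ofNat w (e / 2 ^ φ.half) ∧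
    ∃ (rest : List (Fin φ.numVars × Bool)) (p : ℕ) (b : Bool), rest.length = k ∧
      s.reg 17 = BitVec.ofNat w k ∧ s.reg 11 = BitVec.ofNat w p ∧
      φ.encode.drop p = rest.map litCode ++ tail ∧ s.reg 16 = BitVec.ofNat w b.toNat ∧
      (b || φ.clauseTrue e rest) = φ.clauseTrue e c

theorem runs_literalStep {φ : CNFFormula} (hw : Fits φ w) {e : ℕ} (he : e < 2 ^ w)
    {c : List (Fin φ.numVars × Bool)} {tail : List ℕ} {k : ℕ} {s : State w}
    (h : LiteralInv φ e c tail (k + 1) s) :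
    s.reg 17 ≠ 0#w ∧ Runs literalStep s 16 (LiteralInv φ e c tail k) := by
  obtain ⟨hP, s7, s13, rest, p, b, hk, s17, s11, hdrop, s16, hb⟩ := h
  obtain ⟨l, rest, rfl⟩ := List.exists_cons_of_length_eq_add_one hk
  rw [List.map_cons, List.cons_append] at hdrop
  have hp := (lt_of_drop_eq_cons hdrop).trans hw.formula
  -- The unread literals lie inside the encoding, whose length fits into a word; hence the counter
  -- does not wrap around to 0.
  have hkE : k + 1 < 2 ^ w := by
    have := congrArg List.length hdrop
    have := hw.formula
    simp at *
    omega
  refine ⟨by rw [s17, Ne, ofNat_eq_zero_iff hkE]; omega, ?_⟩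
  refine ((Runs.seq (R := fun s' => Prepared φ s' ∧ s'.reg 7 = BitVec.ofNat w e ∧
      s'.reg 13 = BitVec.ofNat w (e / 2 ^ φ.half) ∧ s'.reg 14 = BitVec.ofNat w (litCode l) ∧
      s'.reg 17 = BitVec.ofNat w (k + 1) ∧ s'.reg 11 = BitVec.ofNat w (p + 1) ∧
      s'.reg 16 = BitVec.ofNat w b.toNat) (T₁ := 3) (T₂ := 13) ?_ ?_).mono le_rfl fun _ => id)
  · refine (Runs.of_loopFree (by simp [Prog.block, Prog.LoopFree]) s).frame.mono (le_of_eq rfl) ?_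
    rintro s' ⟨rfl, hr, ha⟩
    refine ⟨hP.frame (by simp [Prog.block, Prog.WritesReg]) (by simp [Prog.block, Prog.WritesArr])
      hr ha, ?_⟩
    simp [Prog.block, Prog.run, s7, s13, s17, s11, s16, hP.arr0, hP.reg19, eval_add,
      arrOf_of_drop hp hdrop]
  · rintro s' ⟨hP', s7, s13, s14, s17, s11, s16⟩
    refine (Runs.seq (T₁ := 10) (T₂ := 3)
      (runs_litProg hw.two hw.half he (hw.litCode l) hP'.reg2 s7 s13 s14 hP'.reg20).frame ?_)
    rintro s'' ⟨⟨s15, -⟩, hr, ha⟩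
    have hP'' := hP'.frame (by simp [litProg, Prog.block, Prog.WritesReg])
      (by simp [litProg, Prog.block, Prog.WritesArr]) hr ha
    have hr' : ∀ r ∈ [7, 13, 17, 11, 16], s''.reg r = s'.reg r := fun r hmem => hr r (by
      fin_cases hmem <;> simp [litProg, Prog.block, Prog.WritesReg])
    simp only [List.forall_mem_cons] at hr'
    obtain ⟨r7, r13, r17, r11, r16, -⟩ := hr'
    refine (Runs.of_loopFree (by simp [Prog.block, Prog.LoopFree]) s'').frame.mono
      (le_of_eq rfl) ?_
    rintro s₃ ⟨rfl, hr, ha⟩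
    refine ⟨hP''.frame (by simp [Prog.block, Prog.WritesReg]) (by simp [Prog.block, Prog.WritesArr])
      hr ha, by simp [Prog.block, Prog.run, r7, s7], by simp [Prog.block, Prog.run, r13, s13],
      rest, p + 1, b || litTrue φ.half e (litCode l), by simpa using hk, ?_, ?_,
      drop_succ_of_drop hdrop, ?_, ?_⟩
    · simp [Prog.block, Prog.run, r17, s17, hP''.reg19, eval_sub]
    · simp [Prog.block, Prog.run, r11, s11]
    · simp [Prog.block, Prog.run, r16, s16, s15, eval_or_bool]
    · rw [← hb]; simp [clauseTrue, Bool.or_assoc]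

theorem runs_clauseProg {φ : CNFFormula} (hw : Fits φ w) {e v p : ℕ} (he : e < 2 ^ w)
    (hv : v < φ.clauses.length) {tail : List ℕ} {s : State w}
    (hP : Prepared φ s) (s7 : s.reg 7 = BitVec.ofNat w e)
    (s13 : s.reg 13 = BitVec.ofNat w (e / 2 ^ φ.half)) (s11 : s.reg 11 = BitVec.ofNat w p)
    (hdrop : φ.encode.drop p =
      φ.clauses[v].length :: (φ.clauses[v].map litCode ++ tail)) :
    Runs clauseProg s (17 * φ.encode.length + 12) fun s' =>
      s'.reg 18 = BitVec.ofNat w (φ.incident e v).toNat ∧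
      ∃ p', s'.reg 11 = BitVec.ofNat w p' ∧ φ.encode.drop p' = tail := by
  have hp := (lt_of_drop_eq_cons hdrop).trans hw.formula
  have hlen : φ.clauses[v].length ≤ φ.encode.length := by
    have := congrArg List.length hdrop
    simp at this
    omega
  refine Runs.mono (Runs.seq (R := LiteralInv φ e φ.clauses[v] tail φ.clauses[v].length)
    (T₁ := 4) (T₂ := φ.clauses[v].length * (16 + 1) + 1 + 3) ?_ fun s' hs' => ?_) ?_ fun _ => id
  · refine (Runs.of_loopFree (by simp [Prog.block, Prog.LoopFree]) s).frame.mono (le_of_eq rfl) ?_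
    rintro s' ⟨rfl, hr, ha⟩
    refine ⟨hP.frame (by simp [Prog.block, Prog.WritesReg]) (by simp [Prog.block, Prog.WritesArr])
      hr ha, by simp [Prog.block, Prog.run, s7], by simp [Prog.block, Prog.run, s13],
      φ.clauses[v], p + 1, false, rfl, ?_, ?_, drop_succ_of_drop hdrop, ?_, by simp⟩
    · simp [Prog.block, Prog.run, s11, hP.arr0, arrOf_of_drop hp hdrop]
    · simp [Prog.block, Prog.run, s11, hP.reg19, eval_add]
    · simp [Prog.block, Prog.run]
  · refine Runs.seq (Runs.loop (LiteralInv φ e φ.clauses[v] tail)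
      (fun k s h => runs_literalStep hw he h) (fun s h => ?_) _ hs') fun s'' hs'' => ?_
    · obtain ⟨_, _, _, _, _, _, _, h17, _⟩ := h
      exact h17
    obtain ⟨hP', s7, s13, rest, p', b, hk, s17, s11, hdrop, s16, hb⟩ := hs''
    obtain rfl := List.eq_nil_of_length_eq_zero hk
    refine (Runs.of_loopFree (by simp [Prog.block, Prog.LoopFree]) s'').mono (le_of_eq rfl) ?_
    rintro _ rfl
    refine ⟨?_, p', by simp [Prog.block, Prog.run, s11], by simpa using hdrop⟩
    have hside : e / 2 ^ φ.half < 2 ^ w := (Nat.div_le_self _ _).trans_lt he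
    have hone : 1 < 2 ^ w := by have := hw.two; omega
    simp only [clauseTrue, List.any_nil, Bool.or_false] at hb
    simp only [Prog.block, Prog.run, State.reg_setReg, s13, hP'.reg19, s16, eval_eq hside hone]
    norm_num
    rw [eval_eq (toNat_bool_lt hw.pos _) (toNat_bool_lt hw.pos _)]
    simp only [incident, if_pos hv, List.getD_eq_getElem _ _ hv]
    rw [show φ.clauseTrue e φ.clauses[v] = b from hb.symm]
    congr 2
    cases b <;> cases decide (e / 2 ^ φ.half = 1) <;> rfl
  · nlinarith

/-- `reg 18 := incident e v` for a literal `v`. -/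
def literalProg : Prog :=
  .seq (.op .sub 14 9 1) (.seq litProg (.block [.op .lt 22 22 13, .op .or 18 22 15]))

theorem runs_literalProg {φ : CNFFormula} (hw : Fits φ w) {e v : ℕ} (he : e < 2 ^ w)
    (hv : φ.clauses.length ≤ v) (hvw : v < 2 ^ w) {s : State w}
    (hP : Prepared φ s) (s7 : s.reg 7 = BitVec.ofNat w e)
    (s13 : s.reg 13 = BitVec.ofNat w (e / 2 ^ φ.half)) (s9 : s.reg 9 = BitVec.ofNat w v) :
    Runs literalProg s 14 fun s' => s'.reg 18 = BitVec.ofNat w (φ.incident e v).toNat := by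
  have hl : v - φ.clauses.length < 2 ^ w := by omega
  refine Runs.seq (T₁ := 1) (T₂ := 13)
    (Runs.of_loopFree (p := .op .sub 14 9 1) trivial s) ?_
  rintro s' rfl
  refine Runs.seq (T₁ := 10) (T₂ := 3) (runs_litProg hw.two hw.half he hl
    (by simp [Prog.run, hP.reg2]) (by simp [Prog.run, s7]) (by simp [Prog.run, s13])
    (by simp [Prog.run, s9, hP.reg1, eval_sub hv]) (by simp [Prog.run, hP.reg20])).frame ?_
  rintro s'' ⟨⟨s15, s22⟩, hr, -⟩
  have s13' : s''.reg 13 = BitVec.ofNat w (e / 2 ^ φ.half) := by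
    rw [hr 13 (by simp [litProg, Prog.block, Prog.WritesReg])]
    simp [Prog.run, s13]
  refine (Runs.of_loopFree (by simp [Prog.block, Prog.LoopFree]) s'').mono (le_of_eq rfl) ?_
  rintro _ rfl
  have hside : e / 2 ^ φ.half < 2 ^ w := (Nat.div_le_self _ _).trans_lt he
  have hx : (v - φ.clauses.length) / 2 / φ.half < 2 ^ w :=
    ((Nat.div_le_self _ _).trans (Nat.div_le_self _ _)).trans_lt hl
  simp only [Prog.block, Prog.run, State.reg_setReg, s13', s22, s15, eval_lt hx hside]
  norm_num
  rw [eval_or_bool]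
  simp [incident, Nat.not_lt.2 hv]

end WordRAM

/-! ### The loops over vertices and hyperedges. -/

namespace WordRAM

open CNFFormula

variable {w : ℕ}

/-- Append the vertex `v` if it is incident with the hyperedge `e`, and increase `v`. -/
def vertexStep : Prog :=
  .seq (.op .lt 21 9 1) (.seq (.ite 21 clauseProg literalProg)
    (.block [.ite 18 (.seq (.store 32 6 9) (.op .add 6 6 19)) .skip,
      .op .add 9 9 19, .op .sub 10 5 9]))

/-- The invariant of the loop over the vertices. -/
def VertexInv (φ : CNFFormula) (e : ℕ) (pre : List ℕ) (k : ℕ) (s : State w) : Prop :=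
  Prepared φ s ∧ s.reg 7 = BitVec.ofNat w e ∧ s.reg 13 = BitVec.ofNat w (e / 2 ^ φ.half) ∧
    ∃ v p : ℕ, v + k = φ.clauses.length + 4 * φ.half ∧ s.reg 9 = BitVec.ofNat w v ∧
      s.reg 10 = BitVec.ofNat w k ∧ s.reg 11 = BitVec.ofNat w p ∧
      φ.encode.drop p = (φ.clauses.drop v).flatMap (fun c => c.length :: c.map litCode) ∧
      s.reg 6 = BitVec.ofNat w (pre ++ 0 :: φ.vertexList e v).length ∧
      s.arr 32 = arrOf w (pre ++ 0 :: φ.vertexList e v)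

theorem runs_vertexStep {φ : CNFFormula} (hw : Fits φ w) {e : ℕ} (he : e < 2 ^ w)
    {pre : List ℕ} (hpre : pre.length + (φ.clauses.length + 4 * φ.half) + 1 < 2 ^ w) {k : ℕ}
    {s : State w} (h : VertexInv φ e pre (k + 1) s) :
    s.reg 10 ≠ 0#w ∧ Runs vertexStep s (17 * φ.encode.length + 24) (VertexInv φ e pre k) := by
  obtain ⟨hP, s7, s13, v, p, hv, s9, s10, s11, hdrop, s6, s32⟩ := h
  have hvert := hw.vertices
  have hk : k + 1 < 2 ^ w := by omega
  have hvw : v < 2 ^ w := by omega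
  have hC : φ.clauses.length < 2 ^ w := by omega
  refine ⟨by rw [s10, Ne, ofNat_eq_zero_iff hk]; omega, ?_⟩
  refine (Runs.seq (T₁ := 1) (T₂ := 17 * φ.encode.length + 14 + 1 + 7)
    (Runs.of_loopFree (p := .op .lt 21 9 1) trivial s) ?_).mono (by omega) fun _ => id
  rintro s' rfl
  set s₁ := (Prog.op BinOp.lt 21 9 1).run s with hs₁
  have hr₁ : ∀ r, r ≠ 21 → s₁.reg r = s.reg r := fun r hr => by simp [hs₁, Prog.run, hr]
  have ha₁ : s₁.arr = s.arr := by simp [hs₁, Prog.run]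
  have h21 : s₁.reg 21 = BitVec.ofNat w (decide (v < φ.clauses.length)).toNat := by
    simp [hs₁, Prog.run, s9, hP.reg1, eval_lt hvw hC]
  have hP₁ : Prepared φ s₁ := hP.frame (p := .op .lt 21 9 1) (by simp [Prog.WritesReg])
    (by simp [Prog.WritesArr]) (fun r hr => hr₁ r (by simpa [Prog.WritesReg] using hr))
    (fun A _ => by rw [ha₁])
  have s7₁ := (hr₁ 7 (by simp)).trans s7
  have s13₁ := (hr₁ 13 (by simp)).trans s13
  have s9₁ := (hr₁ 9 (by simp)).trans s9
  have s11₁ := (hr₁ 11 (by simp)).trans s11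
  refine Runs.seq (R := fun s' => Prepared φ s' ∧ s'.reg 7 = s.reg 7 ∧ s'.reg 13 = s.reg 13 ∧
    s'.reg 9 = s.reg 9 ∧ s'.reg 6 = s.reg 6 ∧ s'.arr 32 = s.arr 32 ∧
    s'.reg 18 = BitVec.ofNat w (φ.incident e v).toNat ∧
    ∃ p, s'.reg 11 = BitVec.ofNat w p ∧ φ.encode.drop p =
      (φ.clauses.drop (v + 1)).flatMap (fun c => c.length :: c.map litCode))
    (Runs.ite (fun h0 => ?_) (fun h0 => ?_)) ?_
  · have hvc : v < φ.clauses.length := by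
      by_contra hc
      rw [h21] at h0
      simp [hc] at h0
    rw [List.drop_eq_getElem_cons hvc, List.flatMap_cons, List.cons_append] at hdrop
    refine (runs_clauseProg hw he hvc hP₁ s7₁ s13₁ s11₁ hdrop).frame.mono (by omega) ?_
    rintro s' ⟨⟨h18, hp'⟩, hr, ha⟩
    have hreg : ∀ r ∈ [7, 13, 9, 6], s'.reg r = s.reg r := fun r hmem =>
      (hr r (by fin_cases hmem <;>
        simp [clauseProg, literalStep, litProg, Prog.block, Prog.WritesReg])).trans
      (hr₁ r (by fin_cases hmem <;> simp))
    simp only [List.forall_mem_cons] at hreg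
    obtain ⟨r7, r13, r9, r6, -⟩ := hreg
    refine ⟨hP₁.frame (p := clauseProg) ?_ ?_ hr ha, r7, r13, r9, r6, ?_, h18, hp'⟩
    · simp [clauseProg, literalStep, litProg, Prog.block, Prog.WritesReg]
    · simp [clauseProg, literalStep, litProg, Prog.block, Prog.WritesArr]
    · rw [ha 32 (by simp [clauseProg, literalStep, litProg, Prog.block, Prog.WritesArr]), ha₁]
  · have hvc : φ.clauses.length ≤ v := by
      by_contra hc
      rw [h21, ofNat_eq_zero_iff (toNat_bool_lt hw.pos _)] at h0
      simp at h0
      omega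
    refine (runs_literalProg hw he hvc hvw hP₁ s7₁ s13₁ s9₁).frame.mono (by omega) ?_
    rintro s' ⟨h18, hr, ha⟩
    have hreg : ∀ r ∈ [7, 13, 9, 6, 11], s'.reg r = s.reg r := fun r hmem =>
      (hr r (by fin_cases hmem <;>
        simp [literalProg, litProg, Prog.block, Prog.WritesReg])).trans
      (hr₁ r (by fin_cases hmem <;> simp))
    simp only [List.forall_mem_cons] at hreg
    obtain ⟨r7, r13, r9, r6, r11, -⟩ := hreg
    refine ⟨hP₁.frame (p := literalProg) ?_ ?_ hr ha, r7, r13, r9, r6, ?_, h18, p,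
      r11.trans s11, ?_⟩
    · simp [literalProg, litProg, Prog.block, Prog.WritesReg]
    · simp [literalProg, litProg, Prog.block, Prog.WritesArr]
    · rw [ha 32 (by simp [literalProg, litProg, Prog.block, Prog.WritesArr]), ha₁]
    -- Past the clauses nothing is left to read, so the read pointer stays where it is.
    · rw [hdrop, List.drop_eq_nil_of_le hvc, List.drop_eq_nil_of_le (by omega)]
  · rintro s₂ ⟨hP₂, r7, r13, r9, r6, r32, h18, p', s11', hdrop'⟩
    refine (Runs.of_loopFree (by simp [Prog.block, Prog.LoopFree]) s₂).frame.mono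
      (le_of_eq rfl) ?_
    rintro s₃ ⟨hs₃, hr, ha⟩
    have hlen := φ.length_vertexList_le e v
    have hlt : (pre ++ 0 :: φ.vertexList e v).length < 2 ^ w := by
      rw [List.length_append, List.length_cons]; omega
    refine ⟨hP₂.frame (by simp [Prog.block, Prog.WritesReg])
      (by simp [Prog.block, Prog.WritesArr]) hr ha,
      by rw [hr 7 (by simp [Prog.block, Prog.WritesReg]), r7, s7],
      by rw [hr 13 (by simp [Prog.block, Prog.WritesReg]), r13, s13], v + 1, p', by omega, ?_, ?_,
      by rw [hr 11 (by simp [Prog.block, Prog.WritesReg]), s11'], hdrop', ?_⟩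
    · simp only [hs₃, Prog.block, Prog.run]
      split_ifs <;> simp [r9, s9, hP₂.reg19, eval_add]
    · have hsub : φ.clauses.length + 4 * φ.half - (v + 1) = k := by omega
      have hle : v + 1 ≤ φ.clauses.length + 4 * φ.half := by omega
      simp only [hs₃, Prog.block, Prog.run]
      split_ifs <;> simp [r9, s9, hP₂.reg19, hP₂.reg5, eval_add, eval_sub hle, hsub]
    · simp only [hs₃, Prog.block, Prog.run, h18, ofNat_eq_zero_iff (toNat_bool_lt hw.pos _),
        vertexList_succ]
      cases hinc : φ.incident e v
      · simp [r6, s6, r32, s32]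
      · have hup := update_arrOf_length (x := v) hlt
        rw [List.append_assoc, List.cons_append] at hup
        refine ⟨?_, ?_⟩
        · simp [r6, s6, hP₂.reg19, eval_add, Nat.add_assoc]
        · simp only [Bool.toNat_true, one_ne_zero, if_false, if_true, State.arr_setReg,
            State.arr_setArr, r6, s6, r9, s9, r32, s32]
          exact hup

/-- Append the hyperedge `e`, and increase `e`. -/
def edgeStep : Prog :=
  .seq (.block [.op .div 13 7 3, .op .or 12 6 6, .op .add 6 6 19, .const 9 0, .const 11 2,
      .op .or 10 5 5])
    (.seq (.loop 10 vertexStep) (.block [.op .sub 21 6 12, .op .sub 21 21 19, .store 32 12 21,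
      .op .add 7 7 19, .op .sub 8 4 7]))

/-- The invariant of the loop over the hyperedges. -/
def EdgeInv (φ : CNFFormula) (k : ℕ) (s : State w) : Prop :=
  Prepared φ s ∧ ∃ e, e + k = 2 * 2 ^ φ.half + 1 ∧ s.reg 7 = BitVec.ofNat w e ∧
    s.reg 8 = BitVec.ofNat w k ∧
    s.reg 6 = BitVec.ofNat w ((φ.clauses.length + 4 * φ.half) :: (2 * 2 ^ φ.half + 1) ::
      φ.edgeCodes e).length ∧
    s.arr 32 = arrOf w ((φ.clauses.length + 4 * φ.half) :: (2 * 2 ^ φ.half + 1) ::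
      φ.edgeCodes e)

/-- The number of steps for one hyperedge. -/
def edgeStepTime (φ : CNFFormula) : ℕ :=
  (φ.clauses.length + 4 * φ.half) * (17 * φ.encode.length + 25) + 14

theorem runs_edgeStep {φ : CNFFormula} (hw : Fits φ w) {k : ℕ} {s : State w}
    (h : EdgeInv φ (k + 1) s) :
    s.reg 8 ≠ 0#w ∧ Runs edgeStep s (edgeStepTime φ) (EdgeInv φ k) := by
  obtain ⟨hP, e, hek, s7, s8, s6, s32⟩ := h
  have hedges := hw.edges
  have he : e < 2 ^ w := by omega
  have hk : k + 1 < 2 ^ w := by omega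
  have hM : 2 ^ φ.half < 2 ^ w := by omega
  set nV := φ.clauses.length + 4 * φ.half with hnV
  set pre := nV :: (2 * 2 ^ φ.half + 1) :: φ.edgeCodes e with hpre
  -- Block `e` is still to be written; counting it as one of the 2 * 2^h + 1 blocks keeps every
  -- write address within a word.
  have hplen : pre.length + nV + 1 < 2 ^ w := by
    have h1 := φ.length_edgeCodes_le e
    have h2 := hw.hypergraph
    rw [← hnV] at h1 h2
    have h3 : (e + 1) * (nV + 1) ≤ (2 * 2 ^ φ.half + 1) * (nV + 1) :=
      Nat.mul_le_mul_right _ (by omega)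
    rw [Nat.succ_mul] at h3
    simp only [hpre, List.length_cons]
    omega
  refine ⟨by rw [s8, Ne, ofNat_eq_zero_iff hk]; omega, ?_⟩
  refine (Runs.seq (R := fun s' => VertexInv φ e pre nV s' ∧
    s'.reg 12 = BitVec.ofNat w pre.length) (T₁ := 7)
    (T₂ := nV * (17 * φ.encode.length + 25) + 1 + 6) ?_ ?_).mono
      (by unfold edgeStepTime; rw [← hnV]; omega) fun _ => id
  · refine (Runs.of_loopFree (by simp [Prog.block, Prog.LoopFree]) s).frame.mono (le_of_eq rfl) ?_
    rintro s' ⟨hs', hr, ha⟩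
    refine ⟨⟨hP.frame (by simp [Prog.block, Prog.WritesReg])
      (by simp [Prog.block, Prog.WritesArr]) hr ha,
      by rw [hr 7 (by simp [Prog.block, Prog.WritesReg]), s7], ?_, 0, 2, by omega, ?_, ?_, ?_, ?_,
      ?_, ?_⟩, ?_⟩
    · simp [hs', Prog.block, Prog.run, s7, hP.reg3, eval_div he hM, -BitVec.ofNat_pow]
    · simp [hs', Prog.block, Prog.run]
    · simp [hs', Prog.block, Prog.run, hP.reg5, eval_or_self, hnV]
    · simp [hs', Prog.block, Prog.run]
    -- The clauses start at position 2 of the encoding, after the two counts; the formula is read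
    -- anew for each hyperedge.
    · rfl
    · simp [hs', Prog.block, Prog.run, s6, hP.reg19, eval_add, vertexList]
    -- The cell for the cardinality is only skipped: it reads 0 until the vertices have been
    -- written.
    · rw [ha 32 (by simp [Prog.block, Prog.WritesArr]), s32, ← arrOf_append_zero]
      simp [vertexList]
    · simp [hs', Prog.block, Prog.run, s6, eval_or_self]
  · rintro s₁ ⟨hV, s12⟩
    refine Runs.seq (Runs.loop (VertexInv φ e pre)
      (fun k s h => runs_vertexStep hw he hplen h) (fun s h => ?_) _ hV).frame ?_
    · obtain ⟨_, _, _, _, _, _, _, h10, _⟩ := h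
      exact h10
    rintro s₂ ⟨⟨hP₂, s7, s13, v, p, hv, s9, s10, s11, -, s6, s32⟩, hr₂, -⟩
    have s12' : s₂.reg 12 = BitVec.ofNat w pre.length := by
      rw [hr₂ 12 (by simp [vertexStep, clauseProg, literalStep, literalProg, litProg, Prog.block,
        Prog.WritesReg]), s12]
    obtain rfl : v = nV := by omega
    refine (Runs.of_loopFree (by simp [Prog.block, Prog.LoopFree]) s₂).frame.mono
      (le_of_eq rfl) ?_
    rintro s₃ ⟨hs₃, hr, ha⟩
    have hcodes : (nV :: (2 * 2 ^ φ.half + 1) :: φ.edgeCodes (e + 1)) =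
        pre ++ (φ.vertexList e nV).length :: φ.vertexList e nV := by
      rw [edgeCodes_succ]; simp [hpre, hnV]
    refine ⟨hP₂.frame (by simp [Prog.block, Prog.WritesReg])
      (by simp [Prog.block, Prog.WritesArr]) hr ha, e + 1, by omega, ?_, ?_, ?_, ?_⟩
    · simp [hs₃, Prog.block, Prog.run, s7, hP₂.reg19, eval_add]
    · have hsub : 2 * 2 ^ φ.half + 1 - (e + 1) = k := by omega
      have hle : e + 1 ≤ 2 * 2 ^ φ.half + 1 := by omega
      simp only [hs₃, Prog.block, Prog.run]
      simp only [State.reg_setReg, State.reg_setArr, s7, hP₂.reg19, hP₂.reg4]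
      norm_num
      rw [eval_add, eval_sub hle, hsub]
    · rw [hr 6 (by simp [Prog.block, Prog.WritesReg]), s6, hcodes]
      simp
    -- The cardinality is the distance between the write pointer and the reserved cell, minus one
    -- for that cell itself.
    · have h1 : pre.length ≤ (pre ++ 0 :: φ.vertexList e nV).length := by simp
      have h2 : (pre ++ 0 :: φ.vertexList e nV).length - pre.length - 1 =
          (φ.vertexList e nV).length := by simp
      have h3 : 1 ≤ (pre ++ 0 :: φ.vertexList e nV).length - pre.length := by simp
      have hup := update_arrOf_set (w := w) (l := pre ++ 0 :: φ.vertexList e nV) (i := pre.length)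
        (x := (φ.vertexList e nV).length) (by omega) (by simp)
      have hset : (pre ++ 0 :: φ.vertexList e nV).set pre.length (φ.vertexList e nV).length =
          pre ++ (φ.vertexList e nV).length :: φ.vertexList e nV := by
        simp
      rw [hcodes, ← hset, ← hup]
      simp only [hs₃, Prog.block, Prog.run, State.arr_setReg, State.arr_setArr, if_true,
        State.reg_setReg, s32, s12']
      norm_num
      rw [hP₂.reg19, s6, eval_sub h1, eval_sub h3, h2]

/-- Write the hypergraph of the formula in the array `0` into the array `32`. -/
def buildProg : Prog :=
  .seq (.block [.const 19 1, .const 20 2, .const 21 0, .load 0 0 21, .load 1 0 19,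
      .op .div 2 0 20, .op .add 2 2 19, .op .shl 3 19 2, .op .mul 4 20 3, .op .add 4 4 19,
      .const 21 4, .op .mul 5 21 2, .op .add 5 1 5, .const 21 0, .store 32 21 5, .store 32 19 4,
      .const 6 2, .const 7 0, .op .or 8 4 4])
    (.loop 8 edgeStep)

/-- The number of steps of `buildProg`. -/
def buildTime (φ : CNFFormula) : ℕ := (2 * 2 ^ φ.half + 1) * (edgeStepTime φ + 1) + 21

theorem init_arr_zero (input : List ℕ) : (init w input).arr 0 = arrOf w input := by
  funext i; simp [init, arrOf]

/-- Array 32 plays the role of the input array 0 of the simulated program. Registers from 32 and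
arrays from 33 on are untouched and still 0, so that program finds a fresh machine. -/
theorem runs_buildProg {φ : CNFFormula} (hw : Fits φ w) :
    Runs buildProg (init w φ.encode) (buildTime φ) fun s =>
      Prepared φ s ∧ (init w φ.subsetHypergraph.encode).Embeds 32 s := by
  have hn : φ.numVars < 2 ^ w := by have := hw.vertices; have := φ.numVars_lt; omega
  refine (Runs.seq (T₁ := 20) (R := fun s => EdgeInv φ (2 * 2 ^ φ.half + 1) s ∧
    (∀ r, s.reg (r + 32) = 0#w) ∧ (∀ A, s.arr (A + 33) = fun _ => 0#w)) ?_
    fun s hs => (Runs.loop (EdgeInv φ) (fun k s h => runs_edgeStep hw h) ?_ _ hs.1).frame.mono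
      le_rfl (Q' := fun s => Prepared φ s ∧ (init w φ.subsetHypergraph.encode).Embeds 32 s)
      fun s' hs' => ?_).mono (by unfold buildTime; omega) fun _ => id
  · refine (Runs.of_loopFree (by simp [Prog.block, Prog.LoopFree]) _).frame.mono (le_of_eq rfl) ?_
    rintro s ⟨hs, hr, ha⟩
    have h0 : 0 < 2 ^ w := by positivity
    have h1 : 1 < 2 ^ w := by have := hw.two; omega
    have hE0 : arrOf w φ.encode 0#w = BitVec.ofNat w φ.numVars := arrOf_ofNat h0
    have hE1 : arrOf w φ.encode (BitVec.ofNat w 1) = BitVec.ofNat w φ.clauses.length :=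
      arrOf_ofNat h1
    have hdiv := eval_div hn hw.two
    have hhalf : φ.numVars / 2 + 1 = φ.half := rfl
    have hshl := eval_shl (a := 1) hw.half
    rw [one_mul] at hshl
    have hcomp : Prepared φ s ∧ s.reg 6 = BitVec.ofNat w 2 ∧ s.reg 7 = BitVec.ofNat w 0 ∧
        s.reg 8 = BitVec.ofNat w (2 * 2 ^ φ.half + 1) ∧
        s.arr 32 = arrOf w [φ.clauses.length + 4 * φ.half, 2 * 2 ^ φ.half + 1] := by
      have u1 := update_arrOf_length (w := w) (l := []) (x := φ.clauses.length + 4 * φ.half) h0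
      have u2 := update_arrOf_length (w := w) (l := [φ.clauses.length + 4 * φ.half])
        (x := 2 * 2 ^ φ.half + 1) h1
      simp only [List.nil_append, List.length_nil] at u1
      simp only [List.length_singleton, List.cons_append, List.nil_append] at u2
      have u0 : (init w φ.encode).arr 32 = arrOf w [] := by rw [arrOf_nil]; rfl
      refine ⟨⟨?_, ?_, ?_, ?_, ?_, ?_, ?_, ?_⟩, ?_, ?_, ?_, ?_⟩
      all_goals simp [hs, Prog.block, Prog.run, init_arr_zero, hE0, hE1, hdiv, eval_add, hhalf,
        hshl, eval_mul, eval_or_self, u0, u1, u2, -BitVec.ofNat_pow]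
    obtain ⟨hP, s6, s7, s8, s32⟩ := hcomp
    refine ⟨⟨hP, 0, by omega, s7, s8, s6, s32⟩, fun r => ?_, fun A => ?_⟩
    · rw [hr _ (by simp [Prog.block, Prog.WritesReg])]; rfl
    · rw [ha _ (by simp [Prog.block, Prog.WritesArr])]; rfl
  · intro s h
    obtain ⟨_, _, _, _, h8, _⟩ := h
    exact h8
  · obtain ⟨⟨hP, e, he, s7, s8, s6, s32⟩, hr, ha⟩ := hs'
    obtain rfl : e = 2 * 2 ^ φ.half + 1 := by omega
    refine ⟨hP, fun r => ?_, fun A => ?_⟩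
    · rw [hr _ (by simp [edgeStep, vertexStep, clauseProg, literalStep, literalProg, litProg,
        Prog.block, Prog.WritesReg]), hs.2.1]
      rfl
    · rcases A with _ | A
      · rw [init_arr_zero, encode_subsetHypergraph]; exact s32
      · rw [show A + 1 + 32 = A + 33 by omega, ha _ (by simp [edgeStep, vertexStep, clauseProg,
          literalStep, literalProg, litProg, Prog.block, Prog.WritesArr]), hs.2.2]
        funext i; simp [init]

end WordRAM

namespace WordRAM

open CNFFormula

variable {w : ℕ}

/-! ### The program for satisfiability -/

/-- This preserves the registers 3 and 19, which `answerProg` reads after the simulation. -/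
theorem writesReg_clocked {K bud flag r : ℕ} {p : Prog}
    (h : (p.clocked K bud flag).WritesReg r) : r = bud ∨ r = flag ∨ K ≤ r := by
  induction p with
  | skip => exact h.elim
  | const r' k => exact .inr (.inr (by simp only [Prog.clocked, Prog.WritesReg] at h; omega))
  | op o r' a b => exact .inr (.inr (by simp only [Prog.clocked, Prog.WritesReg] at h; omega))
  | load r' A i => exact .inr (.inr (by simp only [Prog.clocked, Prog.WritesReg] at h; omega))
  | store A i r' => exact h.elim
  | seq p q ihp ihq => exact h.elim ihp ihq
  | ite r' p q ihp ihq => exact h.elim ihp ihq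
  | loop r' p ih =>
    simp only [Prog.clocked, Prog.WritesReg, clockTest, clockTick] at h
    tauto

/-- The time limit for the construction of the subset graph. -/
def budget (D q : ℕ) (φ : CNFFormula) : ℕ :=
  (φ.clauses.length + 4 * φ.half) * (φ.clauses.length + 4 * φ.half) * D *
    2 ^ (φ.half * 2 - φ.half / q)

/-- `reg 24 := budget D q φ` -/
def budgetProg (D q : ℕ) : Prog := .block
  [.op .mul 24 5 5, .const 21 D, .op .mul 24 24 21, .op .mul 22 2 20, .const 21 q,
    .op .div 21 2 21, .op .sub 22 22 21, .op .shl 22 19 22, .op .mul 24 24 22]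

theorem runs_budgetProg {φ : CNFFormula} (hw : Fits φ w) {D q : ℕ} (hq : q < 2 ^ w)
    {s s₀ : State w} (hP : Prepared φ s) (hs₀ : s₀.Embeds 32 s) :
    Runs (budgetProg D q) s 10 fun s' => Prepared φ s' ∧ s₀.Embeds 32 s' ∧
      s'.reg 24 = BitVec.ofNat w (budget D q φ) := by
  refine (Runs.of_loopFree (by simp [budgetProg, Prog.block, Prog.LoopFree]) s).frame.mono
    (le_of_eq rfl) ?_
  rintro s' ⟨hs', hr, ha⟩
  refine ⟨hP.frame (by simp [budgetProg, Prog.block, Prog.WritesReg])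
    (by simp [budgetProg, Prog.block, Prog.WritesArr]) hr ha, ⟨fun r => ?_, fun A => ?_⟩, ?_⟩
  · rw [hr _ (by simp [budgetProg, Prog.block, Prog.WritesReg]), hs₀.1]
  · rw [ha _ (by simp [budgetProg, Prog.block, Prog.WritesArr]), hs₀.2]
  · have hle : φ.half / q ≤ φ.half * 2 := (Nat.div_le_self _ _).trans (by omega)
    have hlt : φ.half * 2 - φ.half / q < 2 ^ w :=
      (Nat.sub_le _ _).trans_lt (by have := hw.vertices; omega)
    simp [hs', budgetProg, Prog.block, Prog.run, hP.reg5, hP.reg2, hP.reg20, hP.reg19, eval_mul,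
      eval_div hw.half hq, eval_sub hle, eval_shl hlt, budget, -BitVec.ofNat_pow]

/-- Compare the number of edges with the smallest possible one, and write the answer. -/
def answerProg : Prog := .block
  [.const 21 0, .load 22 33 21, .op .add 23 3 3, .op .eq 22 22 23, .store 1 21 19,
    .ite 24 (.ite 22 (.store 1 21 21) .skip) .skip]

theorem runs_answerProg {φ : CNFFormula} (hw : Fits φ w) {s : State w}
    (s3 : s.reg 3 = BitVec.ofNat w (2 ^ φ.half)) (s19 : s.reg 19 = BitVec.ofNat w 1)
    {a : ℕ} (ha : a = 0 ∨ a = 1)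
    (h : a = 0 ↔ s.reg 24 ≠ 0#w ∧ (s.arr 33 0#w).toNat = 2 * 2 ^ φ.half) :
    Runs answerProg s 11 fun s' => s'.HasOutput [a] := by
  refine (Runs.of_loopFree (by simp [answerProg, Prog.block, Prog.LoopFree]) s).mono
    (le_of_eq rfl) ?_
  rintro _ rfl
  have hM := hw.edges
  have hone : 1#w ≠ 0#w := by
    rw [Ne, ofNat_eq_zero_iff (by have := hw.two; omega)]; omega
  -- The edge count is an arbitrary word here; the comparison is faithful because 2 * 2^h does not
  -- overflow.
  have heq : s.arr 33 0#w = BitVec.ofNat w (2 ^ φ.half + 2 ^ φ.half) ↔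
      (s.arr 33 0#w).toNat = 2 * 2 ^ φ.half := by
    rw [← BitVec.toNat_inj, BitVec.toNat_ofNat, Nat.mod_eq_of_lt (by omega), two_mul]
  have h1w : 1 % 2 ^ w = 1 := Nat.mod_eq_of_lt (by have := hw.two; omega)
  refine ⟨Nat.one_le_two_pow, fun i hi => ?_⟩
  obtain rfl : i = 0 := by simpa using hi
  by_cases h24 : s.reg 24 = 0#w <;> by_cases hc : (s.arr 33 0#w).toNat = 2 * 2 ^ φ.half
  all_goals
    have hval : a = if s.reg 24 ≠ 0#w ∧ (s.arr 33 0#w).toNat = 2 * 2 ^ φ.half then 0 else 1 := by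
      rcases ha with rfl | rfl
      · rw [if_pos (h.1 rfl)]
      · rw [if_neg (fun h' => absurd (h.2 h') one_ne_zero)]
    simp [hval, answerProg, Prog.block, Prog.run, s3, s19, eval_add, eval_eq_word, heq, h24, hc,
      hone, h1w, -BitVec.ofNat_pow]

/-- Decide satisfiability by a construction of subset graphs with a time limit. -/
def satProg (P : Prog) (D q : ℕ) : Prog :=
  .seq buildProg (.seq (budgetProg D q) (.seq (P.clocked 32 24 25) answerProg))

-- The answer 0 requires both an unexhausted clock and the minimal edge count. The simulated run
-- halts with a correct output on every formula; only its time bound is restricted to unsatisfiable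
-- ones.
open Classical in
theorem runs_satProg {P : Prog} {D q : ℕ} {φ : CNFFormula} (hw : Fits φ w) (hq : q < 2 ^ w)
    (hB : budget D q φ < 2 ^ w) {t : ℕ} {s : State w}
    (hexec : Exec P (init w φ.subsetHypergraph.encode) t s)
    (hout : ∃ out, IsEdgeList φ.subsetHypergraph.subsetGraph out ∧ s.HasOutput out)
    (ht : ¬ φ.Satisfiable → t < budget D q φ) :
    Runs (satProg P D q) (init w φ.encode)
      (buildTime φ + (10 + (P.clockCost * (1 + budget D q φ) + 11)))
      fun s' => s'.HasOutput [if φ.Satisfiable then 1 else 0] := by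
  refine Runs.seq (runs_buildProg hw) ?_
  rintro s₁ ⟨hP₁, hE₁⟩
  refine Runs.seq (runs_budgetProg hw hq hP₁ hE₁) ?_
  rintro s₂ ⟨hP₂, hE₂, h24⟩
  have hb : (s₂.reg 24).toNat = budget D q φ := by
    rw [h24, BitVec.toNat_ofNat, Nat.mod_eq_of_lt hB]
  obtain ⟨t', s₃, e₃, ht', hle, htb, hE₃⟩ :=
    hexec.clocked (bud := 24) (flag := 25) (by omega) (by omega) (by omega) s₂ (.inr hE₂)
  rw [hb] at ht' htb
  have hclock : Runs (P.clocked 32 24 25) s₂ (P.clockCost * (1 + budget D q φ))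
      fun s' => s' = s₃ := ⟨t', s₃, e₃, by omega, rfl⟩
  refine Runs.seq hclock ?_
  intro s' hs'
  rw [hs']
  have s3 := e₃.reg_eq (r := 3) fun h => by have := writesReg_clocked h; omega
  have s19 := e₃.reg_eq (r := 19) fun h => by have := writesReg_clocked h; omega
  rw [hP₂.reg3] at s3
  rw [hP₂.reg19] at s19
  refine runs_answerProg hw s3 s19 (by split_ifs <;> simp) ?_
  obtain ⟨out, ⟨l, hnodup, hl, rfl⟩, hout⟩ := hout
  have hcount : (s.arr 1 0#w).toNat = l.length := hout.2 0 (by simp)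
  have hlen := φ.length_eq_iff hnodup hl
  have hz : (if φ.Satisfiable then 1 else 0) = 0 ↔ ¬ φ.Satisfiable := by
    split_ifs with h <;> simp [h]
  rw [hz]
  constructor
  · intro hns
    -- The strict inequality `t < budget D q φ` leaves at least one unit on the clock.
    have h0 : s₃.reg 24 ≠ 0#w := by
      intro h0
      have := ht hns
      rw [h0, BitVec.toNat_ofNat, Nat.zero_mod] at htb
      omega
    refine ⟨h0, ?_⟩
    rw [(hE₃.resolve_left h0).2 1, hcount]
    exact hlen.2 hns
  · rintro ⟨h0, hc⟩
    rw [(hE₃.resolve_left h0).2 1, hcount] at hc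
    exact hlen.1 hc

end WordRAM

/-! ### Running times and word lengths -/

/-- A truly subquadratic function of `N ≤ 3 * 2 ^ h * b` saves a factor exponential in `h`. -/
theorem TrulySubquadratic.exists_lt {T : ℕ → ℝ} (hT : TrulySubquadratic T) :
    ∃ D q : ℕ, 0 < q ∧ ∀ N h b : ℕ, 0 < N → N ≤ 3 * 2 ^ h * b →
      T N < ((b * b * D * 2 ^ (h * 2 - h / q) : ℕ) : ℝ) := by
  obtain ⟨ε, hε, hO⟩ := hT
  obtain ⟨C, hC⟩ := hO.bound
  obtain ⟨N₀, hN₀⟩ := Filter.eventually_atTop.1 hC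
  -- The saving ε is weakened to 1 / q with q = k + 1, so that the budget can be computed by integer
  -- division.
  obtain ⟨k, hk⟩ := exists_nat_one_div_lt hε
  -- The sum covers the finitely many arguments at which the asymptotic bound may fail.
  set S : ℝ := |C| + ∑ i ∈ Finset.range N₀, |T i| with hS
  have hsum : 0 ≤ ∑ i ∈ Finset.range N₀, |T i| := Finset.sum_nonneg fun _ _ => abs_nonneg _
  have hS0 : 0 ≤ S := add_nonneg (abs_nonneg _) hsum
  have hq1 : (1 : ℝ) / ((k + 1 : ℕ) : ℝ) ≤ 1 := by
    rw [div_le_one (by positivity)]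
    exact_mod_cast Nat.succ_le_succ (Nat.zero_le k)
  set δ : ℝ := 1 / ((k + 1 : ℕ) : ℝ) with hδ
  have hδ0 : 0 ≤ δ := by positivity
  have hδε : δ < ε := by simpa [hδ] using hk
  -- The 9 comes from squaring 3 * b; the added 1 makes the inequality strict.
  refine ⟨⌈9 * S⌉₊ + 1, k + 1, Nat.succ_pos _, fun N h b hN hle => ?_⟩
  have hN1 : (1 : ℝ) ≤ N := by exact_mod_cast hN
  have hb : 0 < b := by
    rcases Nat.eq_zero_or_pos b with rfl | hb
    · omega
    · exact hb
  have hpow1 : (1 : ℝ) ≤ (N : ℝ) ^ (2 - δ) := Real.one_le_rpow hN1 (by linarith)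
  have h1 : T N ≤ S * (N : ℝ) ^ (2 - δ) := by
    by_cases hlt : N < N₀
    · have h2 : |T N| ≤ ∑ i ∈ Finset.range N₀, |T i| :=
        Finset.single_le_sum (f := fun i => |T i|) (fun _ _ => abs_nonneg _)
          (Finset.mem_range.2 hlt)
      have h3 : T N ≤ S := (le_abs_self _).trans (h2.trans (by simp [hS]))
      exact h3.trans (le_mul_of_one_le_right hS0 hpow1)
    · have h2 := hN₀ N (not_lt.1 hlt)
      rw [Real.norm_eq_abs, Real.norm_eq_abs,
        abs_of_nonneg (Real.rpow_nonneg (by linarith) _)] at h2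
      have h3 : (N : ℝ) ^ (2 - ε) ≤ (N : ℝ) ^ (2 - δ) :=
        Real.rpow_le_rpow_of_exponent_le hN1 (by linarith)
      calc T N ≤ |T N| := le_abs_self _
        _ ≤ C * (N : ℝ) ^ (2 - ε) := h2
        _ ≤ |C| * (N : ℝ) ^ (2 - ε) :=
          mul_le_mul_of_nonneg_right (le_abs_self _) (Real.rpow_nonneg (by linarith) _)
        _ ≤ S * (N : ℝ) ^ (2 - δ) :=
          mul_le_mul (by simpa [hS] using hsum) h3 (Real.rpow_nonneg (by linarith) _) hS0
  have hb1 : (1 : ℝ) ≤ b := by exact_mod_cast hb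
  have h2 : (N : ℝ) ^ (2 - δ) ≤ 9 * ((b : ℝ) * b * 2 ^ (h * 2 - h / (k + 1))) := by
    have hN3 : (N : ℝ) ≤ (3 * b) * 2 ^ h := by
      have : (N : ℝ) ≤ 3 * 2 ^ h * b := by exact_mod_cast hle
      linarith
    have e1 : ((3 * b : ℝ)) ^ (2 - δ) ≤ (3 * b) ^ 2 := by
      rw [← Real.rpow_natCast]
      exact Real.rpow_le_rpow_of_exponent_le (by linarith) (by push_cast; linarith)
    have e2 : ((2 : ℝ) ^ h) ^ (2 - δ) ≤ 2 ^ (h * 2 - h / (k + 1)) := by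
      rw [← Real.rpow_natCast, ← Real.rpow_natCast, ← Real.rpow_mul (by norm_num)]
      refine Real.rpow_le_rpow_of_exponent_le (by norm_num) ?_
      have hdle : h / (k + 1) ≤ h * 2 := (Nat.div_le_self _ _).trans (by omega)
      rw [Nat.cast_sub hdle]
      have hdiv : ((h / (k + 1) : ℕ) : ℝ) ≤ (h : ℝ) / ((k + 1 : ℕ) : ℝ) := Nat.cast_div_le
      have : (h : ℝ) * δ = (h : ℝ) / ((k + 1 : ℕ) : ℝ) := by rw [hδ]; ring
      push_cast at *
      linarith
    calc (N : ℝ) ^ (2 - δ) ≤ ((3 * b) * 2 ^ h) ^ (2 - δ) :=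
          Real.rpow_le_rpow (by linarith) hN3 (by linarith)
      _ = (3 * b : ℝ) ^ (2 - δ) * ((2 : ℝ) ^ h) ^ (2 - δ) :=
          Real.mul_rpow (by positivity) (by positivity)
      _ ≤ (3 * b) ^ 2 * 2 ^ (h * 2 - h / (k + 1)) :=
          mul_le_mul e1 e2 (by positivity) (by positivity)
      _ = _ := by ring
  have hX : 0 < (b : ℝ) * b * 2 ^ (h * 2 - h / (k + 1)) := by positivity
  calc T N ≤ S * (N : ℝ) ^ (2 - δ) := h1
    _ ≤ S * (9 * ((b : ℝ) * b * 2 ^ (h * 2 - h / (k + 1)))) := mul_le_mul_of_nonneg_left h2 hS0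
    _ = 9 * S * ((b : ℝ) * b * 2 ^ (h * 2 - h / (k + 1))) := by ring
    _ < ((⌈9 * S⌉₊ : ℝ) + 1) * ((b : ℝ) * b * 2 ^ (h * 2 - h / (k + 1))) :=
        mul_lt_mul_of_pos_right ((Nat.le_ceil _).trans_lt (lt_add_one _)) hX
    _ = _ := by push_cast; ring

/-- Polynomial factors are absorbed by a larger base. -/
theorem exists_sq_mul_two_pow_le {Q : ℕ} (hQ : 0 < Q) :
    ∃ δ C : ℝ, 0 < δ ∧ δ < 1 ∧ 0 ≤ C ∧
      ∀ n : ℕ, ((n : ℝ) + 1) ^ 2 * 2 ^ (n - n / Q) ≤ C * (2 - δ) ^ n := by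
  have hQ' : (0 : ℝ) < Q := by exact_mod_cast hQ
  have hQ1 : (1 : ℝ) / Q ≤ 1 := by
    rw [div_le_one hQ']; exact_mod_cast hQ
  set β : ℝ := 2 ^ (1 - 1 / (Q : ℝ)) with hβ
  have hβ1 : 1 ≤ β := Real.one_le_rpow (by norm_num) (by linarith)
  have hβ2 : β < 2 := by
    have : β < (2 : ℝ) ^ (1 : ℝ) :=
      Real.rpow_lt_rpow_of_exponent_lt (by norm_num) (by linarith [div_pos one_pos hQ'])
    simpa using this
  -- The midpoint between β and 2: the ratio β / γ < 1 decays geometrically and absorbs the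
  -- quadratic factor.
  set γ : ℝ := 2 - (2 - β) / 2 with hγ
  have hγβ : β < γ := by rw [hγ]; linarith
  have hγ0 : 0 < γ := by linarith
  have hr0 : 0 < β / γ := by positivity
  have hr1 : β / γ < 1 := (div_lt_one hγ0).2 hγβ
  obtain ⟨B, hB⟩ := (tendsto_pow_const_mul_const_pow_of_abs_lt_one 2
    (by rwa [abs_of_pos hr0] : |β / γ| < 1)).bddAbove_range
  have hB' : ∀ n : ℕ, (n : ℝ) ^ 2 * (β / γ) ^ n ≤ B := fun n => hB ⟨n, rfl⟩
  have hB0 : 0 ≤ B := by simpa using hB' 0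
  refine ⟨(2 - β) / 2, 2 * (B / (β / γ)), by linarith, by linarith, by positivity, fun n => ?_⟩
  rw [← hγ]
  -- The factor 2 pays for rounding in `n / Q`.
  have h1 : (2 : ℝ) ^ (n - n / Q) ≤ 2 * β ^ n := by
    have hdiv : (n : ℝ) / Q - 1 ≤ ((n / Q : ℕ) : ℝ) := by
      rw [← Nat.floor_div_eq_div (K := ℝ)]
      exact (Nat.sub_one_lt_floor _).le
    rw [hβ, ← Real.rpow_natCast, ← Real.rpow_natCast, ← Real.rpow_mul (by norm_num),
      Nat.cast_sub (Nat.div_le_self _ _)]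
    calc (2 : ℝ) ^ ((n : ℝ) - ((n / Q : ℕ) : ℝ)) ≤ 2 ^ (1 + (1 - 1 / (Q : ℝ)) * n) := by
          refine Real.rpow_le_rpow_of_exponent_le (by norm_num) ?_
          have : (1 - 1 / (Q : ℝ)) * n = n - n / Q := by ring
          linarith
      _ = _ := by rw [Real.rpow_add (by norm_num), Real.rpow_one]
  -- The bound is applied at n + 1, which explains the division by one more β / γ.
  have h2 : ((n : ℝ) + 1) ^ 2 * β ^ n ≤ B / (β / γ) * γ ^ n := by
    have := hB' (n + 1)
    rw [pow_succ (β / γ), ← mul_assoc, ← le_div_iff₀ hr0] at this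
    rw [div_pow, ← mul_div_assoc, div_le_iff₀ (by positivity)] at this
    push_cast at this
    exact this
  calc ((n : ℝ) + 1) ^ 2 * 2 ^ (n - n / Q) ≤ ((n : ℝ) + 1) ^ 2 * (2 * β ^ n) :=
        mul_le_mul_of_nonneg_left h1 (by positivity)
    _ = 2 * (((n : ℝ) + 1) ^ 2 * β ^ n) := by ring
    _ ≤ 2 * (B / (β / γ) * γ ^ n) := by linarith
    _ = _ := by ring

/-! ### Word length, total time, and the reduction. -/

namespace WordRAM

open CNFFormula

theorem clauses_length_le (φ : CNFFormula) : φ.clauses.length + 2 ≤ φ.encode.length := by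
  have h : φ.clauses.length ≤ (φ.clauses.flatMap fun c =>
      c.length :: c.map fun l => 2 * (l.1 : ℕ) + l.2.toNat).length := by
    rw [List.length_flatMap]
    simp
  simp only [encode, List.length_cons]
  omega

/-- All numbers in the reduction fit into words of a length linear in
`numVars + log length + 1`. -/
theorem exists_word_length (D q c₀ : ℕ) : ∃ c : ℕ, ∀ (φ : CNFFormula) (w : ℕ),
    c * (φ.numVars + Nat.log 2 φ.length + 1) ≤ w → Fits φ w ∧ q < 2 ^ w ∧
      budget D q φ < 2 ^ w ∧ c₀ * (Nat.log 2 φ.subsetHypergraph.size + 1) ≤ w := by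
  -- With X = 2^S, the hypergraph encoding fits below X^7 and the budget below X^(9 + D); the
  -- summand q gives q ≤ w. Since the size is at most 2^(6S), the word length demanded by `c₀` is at
  -- most 7 * c₀ * S.
  refine ⟨10 + D + q + 7 * c₀, fun φ w hw => ?_⟩
  set S := φ.numVars + Nat.log 2 φ.length + 1 with hS
  have hS1 : 1 ≤ S := by omega
  set X := 2 ^ S with hX
  have hX2 : 2 ≤ X := by simpa using Nat.pow_le_pow_right (n := 2) (by norm_num) hS1
  have hXw : ∀ k, k ≤ 10 + D + q + 7 * c₀ → X ^ k ≤ 2 ^ w := fun k hk => by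
    rw [hX, ← pow_mul, Nat.mul_comm]
    exact Nat.pow_le_pow_right (by norm_num) ((Nat.mul_le_mul_right S hk).trans hw)
  have hL : φ.encode.length < X := by
    have : φ.length < 2 ^ (Nat.log 2 φ.length + 1) := Nat.lt_pow_succ_log_self (by norm_num) _
    exact this.trans_le (Nat.pow_le_pow_right (by norm_num) (by omega))
  have hCL := clauses_length_le φ
  have hhS : φ.half ≤ S := by unfold CNFFormula.half; omega
  have hhX : φ.half ≤ X := hhS.trans Nat.lt_two_pow_self.le
  have hMX : 2 ^ φ.half ≤ X := Nat.pow_le_pow_right (by norm_num) hhS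
  have hnV : φ.clauses.length + 4 * φ.half ≤ 5 * X := by omega
  have hm : 2 * 2 ^ φ.half + 1 ≤ 3 * X := by omega
  have hpow : ∀ k, 2 ^ k ≤ X ^ k := fun k => Nat.pow_le_pow_left hX2 k
  refine ⟨⟨?_, ?_⟩, ?_, ?_, ?_⟩
  · have h1 := Nat.mul_le_mul hm (Nat.succ_le_succ hnV)
    have h2 : 2 + 3 * X * (5 * X + 1) < 2 ^ 5 * X ^ 2 := by nlinarith
    have h3 : 2 ^ 5 * X ^ 2 ≤ X ^ 7 := by
      rw [show X ^ 7 = X ^ 5 * X ^ 2 by ring]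
      exact Nat.mul_le_mul_right _ (hpow 5)
    have h4 := hXw 7 (by omega)
    simp only [Nat.succ_eq_add_one] at h1
    omega
  · exact hL.trans_le ((hXw 1 (by omega)).trans' (by simp))
  · have hqw : q ≤ w := by
      refine le_trans ?_ hw
      calc q ≤ (10 + D + q + 7 * c₀) * 1 := by omega
        _ ≤ _ := Nat.mul_le_mul_left _ hS1
    exact Nat.lt_two_pow_self.trans_le (Nat.pow_le_pow_right (by norm_num) hqw)
  · have h1 : 2 ^ (φ.half * 2 - φ.half / q) ≤ X ^ 2 := by
      calc 2 ^ (φ.half * 2 - φ.half / q) ≤ 2 ^ (φ.half * 2) :=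
            Nat.pow_le_pow_right (by norm_num) (Nat.sub_le _ _)
        _ = (2 ^ φ.half) ^ 2 := pow_mul _ _ _
        _ ≤ X ^ 2 := Nat.pow_le_pow_left hMX 2
    have hD : D ≤ X ^ D := Nat.lt_two_pow_self.le.trans (hpow D)
    have hXpos : 0 < X := by omega
    calc budget D q φ ≤ (5 * X) * (5 * X) * X ^ D * X ^ 2 :=
          Nat.mul_le_mul (Nat.mul_le_mul (Nat.mul_le_mul hnV hnV) hD) h1
      _ = 25 * (X ^ D * X ^ 4) := by ring
      _ < 2 ^ 5 * (X ^ D * X ^ 4) := Nat.mul_lt_mul_of_pos_right (by norm_num) (by positivity)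
      _ ≤ X ^ 5 * (X ^ D * X ^ 4) := Nat.mul_le_mul_right _ (hpow 5)
      _ = X ^ (9 + D) := by ring
      _ ≤ 2 ^ w := hXw _ (by omega)
  · have hsize : φ.subsetHypergraph.size ≤ 2 ^ (6 * S) := by
      calc φ.subsetHypergraph.size ≤ (3 * X) * (5 * X) :=
            φ.subsetHypergraph.size_le.trans (Nat.mul_le_mul hm hnV)
        _ ≤ 2 ^ 4 * X ^ 2 := by nlinarith
        _ ≤ X ^ 4 * X ^ 2 := Nat.mul_le_mul_right _ (hpow 4)
        _ = 2 ^ (6 * S) := by rw [hX]; ring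
    have hlog : Nat.log 2 φ.subsetHypergraph.size ≤ 6 * S := by
      calc Nat.log 2 φ.subsetHypergraph.size ≤ Nat.log 2 (2 ^ (6 * S)) := Nat.log_mono_right hsize
        _ = 6 * S := Nat.log_pow (by norm_num) _
    calc c₀ * (Nat.log 2 φ.subsetHypergraph.size + 1) ≤ c₀ * (7 * S) :=
          Nat.mul_le_mul_left _ (by omega)
      _ = 7 * c₀ * S := by ring
      _ ≤ (10 + D + q + 7 * c₀) * S := Nat.mul_le_mul_right _ (by omega)
      _ ≤ w := hw

/-- With b vertices, formula length L and Y the power of 2 in the budget, all phases are bounded by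
a multiple of Y * b^2 * L. Writing the hypergraph takes only about 2^h * b * L steps, and 2^h ≤ Y.
-/
theorem total_time_le (κ D : ℕ) {q : ℕ} (φ : CNFFormula) :
    buildTime φ + (10 + (κ * (1 + budget D q φ) + 11)) ≤
      100 * (250 + κ + κ * D) * φ.encode.length ^ 3 *
        ((φ.numVars + 1) ^ 2 * 2 ^ (φ.numVars - φ.numVars / (2 * q))) := by
  set L := φ.encode.length with hL
  set b := φ.clauses.length + 4 * φ.half with hb
  set Y := 2 ^ (φ.half * 2 - φ.half / q) with hY
  set n := φ.numVars with hn
  have hhalf : φ.half = n / 2 + 1 := rfl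
  have hCL := clauses_length_le φ
  have hL1 : 1 ≤ L := by omega
  have hb1 : 1 ≤ b := by omega
  have hY1 : 1 ≤ Y := Nat.one_le_two_pow
  have hMY : 2 ^ φ.half ≤ Y := by
    refine Nat.pow_le_pow_right (by norm_num) ?_
    have := Nat.div_le_self φ.half q
    omega
  -- The factor 4 is 2^2, because 2 * `half` ≤ n + 2; moreover n / 2 ≤ `half` preserves the saving.
  have hYn : Y ≤ 4 * 2 ^ (n - n / (2 * q)) := by
    rw [show 4 * 2 ^ (n - n / (2 * q)) = 2 ^ (2 + (n - n / (2 * q))) by rw [pow_add]; norm_num]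
    refine Nat.pow_le_pow_right (by norm_num) ?_
    have h1 : n / (2 * q) ≤ φ.half / q := by
      rw [← Nat.div_div_eq_div_mul]
      exact Nat.div_le_div_right (by omega)
    have h2 : n / (2 * q) ≤ n := Nat.div_le_self _ _
    omega
  have hbL : b ≤ 5 * L * (n + 1) := by
    have h1 : b ≤ L + 4 * (n + 1) := by omega
    have h2 : n + 1 ≤ L * (n + 1) := Nat.le_mul_of_pos_left _ hL1
    have h3 : L ≤ L * (n + 1) := Nat.le_mul_of_pos_right _ (Nat.succ_pos n)
    rw [Nat.mul_assoc]
    omega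
  have hbuild : buildTime φ ≤ 229 * (Y * b * b * L) := by
    have hLb : 1 ≤ b * L := Nat.mul_pos hb1 hL1
    have hYbL : 1 ≤ Y * (b * L) := Nat.mul_pos hY1 hLb
    have h1 : edgeStepTime φ + 1 ≤ 57 * (b * L) := by
      unfold edgeStepTime
      rw [← hb, ← hL]
      nlinarith
    have h2 : buildTime φ ≤ 3 * Y * (57 * (b * L)) + 21 := by
      unfold buildTime
      exact Nat.add_le_add_right (Nat.mul_le_mul (by omega) h1) _
    have h3 : Y * (b * L) ≤ Y * b * b * L := by
      calc Y * (b * L) ≤ b * (Y * (b * L)) := Nat.le_mul_of_pos_left _ hb1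
        _ = _ := by ring
    nlinarith
  have hZ : 1 ≤ Y * b * b * L := Nat.mul_pos (Nat.mul_pos (Nat.mul_pos hY1 hb1) hb1) hL1
  have hbud : budget D q φ ≤ D * (Y * b * b * L) := by
    calc budget D q φ = D * (Y * b * b) * 1 := by
          unfold budget
          rw [← hb, ← hY]
          ring
      _ ≤ D * (Y * b * b) * L := Nat.mul_le_mul_left _ hL1
      _ = _ := by ring
  have hsum : buildTime φ + (10 + (κ * (1 + budget D q φ) + 11)) ≤
      (250 + κ + κ * D) * (Y * b * b * L) := by
    have h1 := Nat.mul_le_mul_left κ (Nat.add_le_add hZ hbud)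
    nlinarith
  refine hsum.trans ?_
  -- The final 100 is 4 * 5 * 5, and the exponent 3 of L collects one L from each b and the L
  -- already present.
  calc (250 + κ + κ * D) * (Y * b * b * L) ≤ (250 + κ + κ * D) *
        ((4 * 2 ^ (n - n / (2 * q))) * (5 * L * (n + 1)) * (5 * L * (n + 1)) * L) :=
        Nat.mul_le_mul_left _ (Nat.mul_le_mul_right _ (Nat.mul_le_mul (Nat.mul_le_mul hYn hbL) hbL))
    _ = _ := by ring

/-- A fast construction of sparse subset graphs yields a fast satisfiability test. -/
theorem exists_decidesSAT {P : Prog} {T : ℕ → ℝ} (hT : TrulySubquadratic T)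
    (hP : ConstructsSubsetGraphs P FinHypergraph.HasSparseSubsetGraph T) :
    ∃ ε : ℝ, 0 < ε ∧ ε < 1 ∧ ∃ (P' : Prog) (C : ℝ) (k : ℕ),
      DecidesSAT P' fun φ => C * (2 - ε) ^ φ.numVars * (φ.length : ℝ) ^ k := by
  obtain ⟨D, q, hq, hTlt⟩ := hT.exists_lt
  obtain ⟨c₀, hc₀⟩ := hP
  obtain ⟨c, hc⟩ := exists_word_length D q c₀
  obtain ⟨δ, C, hδ0, hδ1, hC, hpow⟩ := exists_sq_mul_two_pow_le (Q := 2 * q) (by omega)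
  set A : ℕ := 100 * (250 + P.clockCost + P.clockCost * D) with hA
  refine ⟨δ, hδ0, hδ1, satProg P D q, A * C, 3, c, fun φ w hw => ?_⟩
  obtain ⟨hfits, hqw, hB, hsize⟩ := hc φ w hw
  obtain ⟨t, s, hexec, hout, ht⟩ := hc₀ φ.subsetHypergraph
    (FinHypergraph.isAcyclic_of_edge_eq_univ _ φ.edge_lastEdge)
    (FinHypergraph.connected_of_edge_eq_univ _ φ.edge_lastEdge) w hsize
  -- Sparseness enters here only: unsatisfiability makes the time bound applicable.
  have htlt : ¬ φ.Satisfiable → t < budget D q φ := fun hns => by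
    have hle : φ.subsetHypergraph.size ≤
        3 * 2 ^ φ.half * (φ.clauses.length + 4 * φ.half) := by
      refine φ.subsetHypergraph.size_le.trans (Nat.mul_le_mul_right _ ?_)
      have : 1 ≤ 2 ^ φ.half := Nat.one_le_two_pow
      change 2 * 2 ^ φ.half + 1 ≤ _
      omega
    have := (ht (φ.hasSparseSubsetGraph hns)).trans_lt
      (hTlt _ _ _ (φ.subsetHypergraph.size_pos φ.lastEdge) hle)
    exact_mod_cast this
  obtain ⟨t', s', hexec', ht', hout'⟩ := runs_satProg hfits hqw hB hexec hout htlt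
  refine ⟨t', s', hexec', hout', ?_⟩
  have h1 := ht'.trans (total_time_le P.clockCost D (q := q) φ)
  have h2 : (t' : ℝ) ≤ A * (φ.length : ℝ) ^ 3 *
      (((φ.numVars : ℝ) + 1) ^ 2 * 2 ^ (φ.numVars - φ.numVars / (2 * q))) := by
    exact_mod_cast h1
  calc (t' : ℝ) ≤ _ := h2
    _ ≤ A * (φ.length : ℝ) ^ 3 * (C * (2 - δ) ^ φ.numVars) :=
        mul_le_mul_of_nonneg_left (hpow _) (by positivity)
    _ = _ := by ring

end WordRAM

theorem mainTheorem2 (hSETH : SETH) :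
    (¬ ∃ (P : WordRAM.Prog) (T : ℕ → ℝ), TrulySubquadratic T ∧
      ConstructsSubsetGraphs P (fun _ => True) T) ∧
    (¬ ∃ (P : WordRAM.Prog) (T : ℕ → ℝ), TrulySubquadratic T ∧
      ConstructsSubsetGraphs P FinHypergraph.HasSparseSubsetGraph T) := by
  have key : ¬ ∃ (P : WordRAM.Prog) (T : ℕ → ℝ), TrulySubquadratic T ∧
      ConstructsSubsetGraphs P FinHypergraph.HasSparseSubsetGraph T := by
    rintro ⟨P, T, hT, hP⟩
    obtain ⟨ε, hε0, hε1, h⟩ := WordRAM.exists_decidesSAT hT hP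
    exact hSETH ε hε0 hε1 h
  refine ⟨?_, key⟩
  -- A time bound on all acyclic hypergraphs is in particular one on those with sparse subset graph.
  rintro ⟨P, T, hT, c, hc⟩
  refine key ⟨P, T, hT, c, fun H hH hconn w hw => ?_⟩
  obtain ⟨t, s, hexec, hout, ht⟩ := hc H hH hconn w hw
  exact ⟨t, s, hexec, hout, fun _ => ht trivial⟩
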